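/- Let $\tilde H_1=\{u\in C^2[0,1]: u(0)=u'(0)=0\}$ and $\tilde H_2=\{u\in C^1[0,1]: u(0)=0\}$ (complex-valued functions), with the inner products $(u|v)_1=\int_0^1 u'(\rho)\overline{v'(\rho)}\,\frac{d\rho}{\rho^2}$ and $(u|v)_2=\int_0^1 u'(\rho)\overline{v'(\rho)}\,d\rho$, and let $\mathcal H$ be the Hilbert space obtained by completing $\tilde{\mathcal H}=\tilde H_1\times\tilde H_2$ with respect to $(\mathbf u|\mathbf v)=(u_1|v_1)_1+(u_2|v_2)_2$. Let $\tilde L_0$ be the unbounded operator in $\mathcal H$ with domain $$\mathcal D(\tilde L_0)=\{u\in C^3[0,1]: u(0)=u'(0)=u''(0)=0\}\times\{u\in C^3[0,1]: u(0)=0\}$$ given by $$\tilde L_0\mathbf u(\rho)=\begin{pmatrix}-\rho u_1'(\rho)+u_1(\rho)+\rho u_2'(\rho)-u_2(\rho)\\ \frac1\rho u_1'(\rho)-\rho u_2'(\rho)\end{pmatrix},$$ let $L_0$ be its closure, let $L'\in\mathcal B(\mathcal H)$ be the bounded extension of $$L'\mathbf u(\rho)=\begin{pmatrix}-V_1(\rho)\int_0^\rho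 \rho' u_2(\rho')\,d\rho'\\ 0\end{pmatrix},\quad \mathbf u\in\tilde{\mathcal H},\qquad V_1(\rho)=-\frac{16}{(1+\rho^2)^2},$$ and let $L=L_0+L'$ with domain $\mathcal D(L_0)$. Write $\sigma(L)$ for the spectrum of $L$ and $R_L(\lambda)=(\lambda-L)^{-1}\in\mathcal B(\mathcal H)$ for its resolvent. Then for every $\varepsilon>0$: 1. there are constants $M,C$ such that for all $\lambda\in\mathbb C$ with $\operatorname{Re}\lambda\ge-\frac12+\varepsilon$ and $|\lambda|\ge M$ the resolvent $R_L(\lambda)$ exists and $\|R_L(\lambda)\|\le C$; 2. in particular, there is a constant $N$ such that no $\lambda\in\mathbb C$ with $\operatorname{Re}\lambda\ge-\frac12+\varepsilon$ and $|\operatorname{Im}\lambda|\ge N$ belongs to $\sigma(L)$. Hence there is a constant $N$ such that $L$ has no eigenvalue $\lambda$ with $\operatorname{Re}\lambda\ge0$ and $|\operatorname{Im}\lambda|\ge N$. -/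

import Mathlib

open Set Filter Topology MeasureTheory
open scoped ComplexConjugate InnerProductSpace

namespace WaveMap

/-- The closed unit interval of the radial variable `ρ`. -/
abbrev I : Set ℝ := Icc 0 1

/-- The derivative `u'` on `[0,1]`, one-sided at the end points. -/
noncomputable def D (u : ℝ → ℂ) : ℝ → ℂ := derivWithin u I

/-- `C^k[0,1]`: complex-valued functions that are `k` times continuously differentiable on `[0,1]`
up to the end points. Outside `[0,1]` they are set to zero, so that an element is nothing but
a function on `[0,1]`. -/
def Ck (k : ℕ) : Submodule ℂ (ℝ → ℂ) where
  carrier := {u | ContDiffOn ℝ k u I ∧ ∀ ρ ∉ I, u ρ = 0}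
  add_mem' := fun hu hv =>
    ⟨hu.1.add hv.1, fun ρ hρ => by simp [hu.2 ρ hρ, hv.2 ρ hρ]⟩
  zero_mem' := ⟨contDiffOn_const, fun _ _ => rfl⟩
  smul_mem' := fun c u hu => ⟨hu.1.const_smul c, fun ρ hρ => by simp [hu.2 ρ hρ]⟩

theorem uniqueDiff : UniqueDiffOn ℝ I := uniqueDiffOn_Icc one_pos

theorem zero_mem_I : (0 : ℝ) ∈ I := ⟨le_rfl, zero_le_one⟩

theorem contDiffOn_D {u : ℝ → ℂ} {n m : ℕ} (hu : ContDiffOn ℝ n u I) (h : m + 1 ≤ n) :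
    ContDiffOn ℝ m (D u) I :=
  hu.derivWithin uniqueDiff (by exact_mod_cast h)

theorem diffOn {u : ℝ → ℂ} {n : ℕ} (hu : ContDiffOn ℝ n u I) (h : 1 ≤ n) :
    DifferentiableOn ℝ u I :=
  hu.differentiableOn (by have : n ≠ 0 := by omega
                          exact_mod_cast this)

theorem hasD {u : ℝ → ℂ} {n : ℕ} (hu : ContDiffOn ℝ n u I) (h : 1 ≤ n) {ρ : ℝ} (hρ : ρ ∈ I) :
    HasDerivWithinAt u (D u ρ) I ρ :=
  (diffOn hu h ρ hρ).hasDerivWithinAt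

theorem D_eq {u : ℝ → ℂ} {c : ℂ} {ρ : ℝ} (hρ : ρ ∈ I) (h : HasDerivWithinAt u c I ρ) :
    D u ρ = c :=
  h.derivWithin (uniqueDiff ρ hρ)

theorem D_congr {u v : ℝ → ℂ} (h : EqOn u v I) {ρ : ℝ} (hρ : ρ ∈ I) : D u ρ = D v ρ :=
  derivWithin_congr h (h hρ)

theorem D_add {u v : ℝ → ℂ} {n : ℕ} (hn : 1 ≤ n) (hu : ContDiffOn ℝ n u I)
    (hv : ContDiffOn ℝ n v I) {ρ : ℝ} (hρ : ρ ∈ I) : D (u + v) ρ = D u ρ + D v ρ :=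
  D_eq hρ ((hasD hu hn hρ).add (hasD hv hn hρ))

theorem D_smul {u : ℝ → ℂ} {n : ℕ} (hn : 1 ≤ n) (c : ℂ) (hu : ContDiffOn ℝ n u I)
    {ρ : ℝ} (hρ : ρ ∈ I) : D (c • u) ρ = c * D u ρ :=
  D_eq hρ ((hasD hu hn hρ).const_smul c)

theorem norm_le_mul {g : ℝ → ℂ} (hg : ContDiffOn ℝ (1 : ℕ) g I) (h0 : g 0 = 0) :
    ∃ C : ℝ, 0 ≤ C ∧ ∀ ρ ∈ I, ‖g ρ‖ ≤ C * ρ := by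
  obtain ⟨C, hC⟩ := (isCompact_Icc (a := (0 : ℝ)) (b := 1)).exists_bound_of_continuousOn
    (contDiffOn_D hg (m := 0) (by norm_num)).continuousOn
  refine ⟨C, (norm_nonneg _).trans (hC 0 zero_mem_I), fun ρ hρ => ?_⟩
  have := (convex_Icc (0 : ℝ) 1).norm_image_sub_le_of_norm_hasDerivWithin_le
    (fun x hx => hasD hg le_rfl hx) hC zero_mem_I hρ
  simpa [h0, abs_of_nonneg hρ.1] using this

theorem eq_zero_of_D_ae {u : ℝ → ℂ} {n : ℕ} (hn : 1 ≤ n) (hu : u ∈ Ck n) (h0 : u 0 = 0)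
    (h : ∀ᵐ ρ ∂(volume.restrict (Ioc (0 : ℝ) 1)), D u ρ = 0) : u = 0 := by
  funext ρ
  by_cases hρ : ρ ∈ I
  swap
  · exact hu.2 ρ hρ
  have hc : ContinuousOn (D u) I := (contDiffOn_D hu.1 (m := 0) (by omega)).continuousOn
  have hsub : Icc 0 ρ ⊆ I := Icc_subset_Icc_right hρ.2
  have h1 : ∫ x in (0 : ℝ)..ρ, D u x = u ρ - u 0 := by
    refine intervalIntegral.integral_eq_sub_of_hasDerivAt_of_le hρ.1
      (hu.1.continuousOn.mono hsub) (fun x hx => ?_) ?_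
    · have hx' : x ∈ Ioo (0 : ℝ) 1 := ⟨hx.1, hx.2.trans_le hρ.2⟩
      exact (hasD hu.1 hn (Ioo_subset_Icc_self hx')).hasDerivAt (Icc_mem_nhds hx'.1 hx'.2)
    · exact (hc.mono hsub).intervalIntegrable_of_Icc hρ.1
  have h2 : ∫ x in (0 : ℝ)..ρ, D u x = 0 := by
    rw [intervalIntegral.integral_of_le hρ.1]
    refine integral_eq_zero_of_ae ?_
    exact ae_restrict_of_ae_restrict_of_subset (Ioc_subset_Ioc_right hρ.2) h
  rw [h2, h0, sub_zero] at h1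
  exact h1.symm

/-- `{u ∈ C²[0,1] : u(0) = u'(0) = 0}` as a subspace of the functions. -/
noncomputable def preH1 : Submodule ℂ (ℝ → ℂ) where
  carrier := {u | u ∈ Ck 2 ∧ u 0 = 0 ∧ D u 0 = 0}
  add_mem' := fun {u v} hu hv => ⟨add_mem hu.1 hv.1, by simp [hu.2.1, hv.2.1], by
    rw [D_add (n := 2) (by norm_num) hu.1.1 hv.1.1 zero_mem_I, hu.2.2, hv.2.2, add_zero]⟩
  zero_mem' := ⟨zero_mem _, rfl, by simp [D, derivWithin_zero]⟩
  smul_mem' := fun c u hu => ⟨Submodule.smul_mem _ c hu.1, by simp [hu.2.1], by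
    rw [D_smul (n := 2) (by norm_num) c hu.1.1 zero_mem_I, hu.2.2, mul_zero]⟩

/-- `{u ∈ C¹[0,1] : u(0) = 0}` as a subspace of the functions. -/
noncomputable def preH2 : Submodule ℂ (ℝ → ℂ) where
  carrier := {u | u ∈ Ck 1 ∧ u 0 = 0}
  add_mem' := fun {u v} hu hv => ⟨add_mem hu.1 hv.1, by simp [hu.2, hv.2]⟩
  zero_mem' := ⟨zero_mem _, rfl⟩
  smul_mem' := fun c u hu => ⟨Submodule.smul_mem _ c hu.1, by simp [hu.2]⟩

/-- The space `H̃₁` (a type of its own, so that it carries no other topology than the one of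
the inner product below). -/
noncomputable def H1t : Type := preH1

/-- The space `H̃₂` (a type of its own, for the same reason). -/
noncomputable def H2t : Type := preH2

noncomputable instance : AddCommGroup H1t := inferInstanceAs (AddCommGroup preH1)
noncomputable instance : Module ℂ H1t := inferInstanceAs (Module ℂ preH1)
noncomputable instance : AddCommGroup H2t := inferInstanceAs (AddCommGroup preH2)
noncomputable instance : Module ℂ H2t := inferInstanceAs (Module ℂ preH2)

/-- The underlying function of an element of `H̃₁`. -/
noncomputable def H1t.fn : H1t →ₗ[ℂ] (ℝ → ℂ) := preH1.subtype

/-- The underlying function of an element of `H̃₂`. -/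
noncomputable def H2t.fn : H2t →ₗ[ℂ] (ℝ → ℂ) := preH2.subtype

theorem H1t.mem (u : H1t) : u.fn ∈ preH1 := u.2

theorem H2t.mem (u : H2t) : u.fn ∈ preH2 := u.2

theorem H1t.fn_injective : Function.Injective H1t.fn := Subtype.val_injective

theorem H2t.fn_injective : Function.Injective H2t.fn := Subtype.val_injective

theorem contOn_D1 (u : H1t) : ContinuousOn (D u.fn) I :=
  (contDiffOn_D u.mem.1.1 (m := 0) (by norm_num)).continuousOn

theorem contOn_D2 (u : H2t) : ContinuousOn (D u.fn) I :=
  (contDiffOn_D u.mem.1.1 (m := 0) (by norm_num)).continuousOn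

theorem integrable1 (u v : H1t) :
    IntervalIntegrable (fun ρ : ℝ => conj (D u.fn ρ) * D v.fn ρ / (ρ : ℂ) ^ 2) volume 0 1 := by
  obtain ⟨A, hA0, hA⟩ := norm_le_mul (contDiffOn_D u.mem.1.1 (m := 1) (by norm_num)) u.mem.2.2
  obtain ⟨B, hB0, hB⟩ := norm_le_mul (contDiffOn_D v.mem.1.1 (m := 1) (by norm_num)) v.mem.2.2
  rw [intervalIntegrable_iff_integrableOn_Ioc_of_le zero_le_one]
  refine IntegrableOn.of_bound (by simp) ?_ (A * B) ?_
  · have hc : ContinuousOn (fun ρ : ℝ => conj (D u.fn ρ) * D v.fn ρ / (ρ : ℂ) ^ 2)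
        (Ioc (0 : ℝ) 1) := by
      refine ContinuousOn.div ?_
        (Complex.continuous_ofReal.pow 2).continuousOn ?_
      · exact (Complex.continuous_conj.comp_continuousOn
          ((contOn_D1 u).mono Ioc_subset_Icc_self)).mul ((contOn_D1 v).mono Ioc_subset_Icc_self)
      · intro x hx
        have h0 : x ≠ 0 := ne_of_gt hx.1
        exact pow_ne_zero 2 (by exact_mod_cast h0)
    exact hc.aestronglyMeasurable measurableSet_Ioc
  · refine (ae_restrict_iff' measurableSet_Ioc).2 (ae_of_all _ fun x hx => ?_)
    have hx' := Ioc_subset_Icc_self hx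
    have h0 : (0 : ℝ) < x := hx.1
    rw [norm_div, norm_mul, norm_pow, Complex.norm_real, Real.norm_eq_abs, sq_abs,
      div_le_iff₀ (by positivity), RCLike.norm_conj]
    calc ‖D u.fn x‖ * ‖D v.fn x‖ ≤ (A * x) * (B * x) :=
          mul_le_mul (hA x hx') (hB x hx') (norm_nonneg _) (by positivity)
      _ = A * B * x ^ 2 := by ring

theorem integrable2 (u v : H2t) :
    IntervalIntegrable (fun ρ : ℝ => conj (D u.fn ρ) * D v.fn ρ) volume 0 1 :=
  ((Complex.continuous_conj.comp_continuousOn (contOn_D2 u)).mul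
    (contOn_D2 v)).intervalIntegrable_of_Icc zero_le_one

theorem self1 (u : H1t) : (∫ ρ in (0 : ℝ)..1, conj (D u.fn ρ) * D u.fn ρ / (ρ : ℂ) ^ 2) =
    ((∫ ρ in (0 : ℝ)..1, ‖D u.fn ρ‖ ^ 2 / ρ ^ 2 : ℝ) : ℂ) := by
  rw [← intervalIntegral.integral_ofReal]
  congr 1; funext ρ
  rw [RCLike.conj_mul]; push_cast; rfl

theorem self2 (u : H2t) : (∫ ρ in (0 : ℝ)..1, conj (D u.fn ρ) * D u.fn ρ) =
    ((∫ ρ in (0 : ℝ)..1, ‖D u.fn ρ‖ ^ 2 : ℝ) : ℂ) := by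
  rw [← intervalIntegral.integral_ofReal]
  congr 1; funext ρ
  rw [RCLike.conj_mul]; push_cast; rfl

theorem integrable1_self (u : H1t) :
    IntervalIntegrable (fun ρ : ℝ => ‖D u.fn ρ‖ ^ 2 / ρ ^ 2) volume 0 1 := by
  have h := (integrable1 u u).norm
  refine h.congr (fun ρ _ => ?_)
  simp [sq]

theorem integrable2_self (u : H2t) :
    IntervalIntegrable (fun ρ : ℝ => ‖D u.fn ρ‖ ^ 2) volume 0 1 := by
  have h := (integrable2 u u).norm
  refine h.congr (fun ρ _ => ?_)
  simp [sq]

/-- The inner product `(u|v)₁ = ∫₀¹ u' v̄' dρ/ρ²` on `H̃₁`; following Mathlib's convention it is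
conjugate linear in its first argument, so that `inner u v` is `(v|u)₁`. -/
@[reducible] noncomputable def core1 : InnerProductSpace.Core ℂ H1t where
  inner u v := ∫ ρ in (0 : ℝ)..1, conj (D u.fn ρ) * D v.fn ρ / (ρ : ℂ) ^ 2
  conj_inner_symm u v := by
    simp only [intervalIntegral.integral_of_le zero_le_one]
    rw [← integral_conj]
    congr 1; funext ρ
    simp [mul_comm]
  re_inner_nonneg u := by
    rw [self1]
    exact intervalIntegral.integral_nonneg zero_le_one fun ρ _ => by positivity
  add_left u v w := by
    rw [← intervalIntegral.integral_add (integrable1 u w) (integrable1 v w)]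
    refine intervalIntegral.integral_congr fun ρ hρ => ?_
    rw [uIcc_of_le zero_le_one] at hρ
    simp only [map_add]
    rw [D_add (n := 2) (by norm_num) u.mem.1.1 v.mem.1.1 hρ, map_add]
    ring
  smul_left u v c := by
    rw [← intervalIntegral.integral_const_mul]
    refine intervalIntegral.integral_congr fun ρ hρ => ?_
    rw [uIcc_of_le zero_le_one] at hρ
    simp only [map_smul]
    rw [D_smul (n := 2) (by norm_num) c u.mem.1.1 hρ, map_mul]
    ring
  definite u h := by
    rw [self1] at h
    have h' := Complex.ofReal_eq_zero.1 h
    rw [intervalIntegral.integral_eq_zero_iff_of_le_of_nonneg_ae zero_le_one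
      (ae_of_all _ fun ρ => by positivity) (integrable1_self u)] at h'
    refine H1t.fn_injective (eq_zero_of_D_ae (n := 2) (by norm_num) u.mem.1 u.mem.2.1 ?_)
    filter_upwards [h', ae_restrict_mem measurableSet_Ioc] with ρ h1 h2
    have : ρ ≠ 0 := h2.1.ne'
    simpa [this] using h1

/-- The inner product `(u|v)₂ = ∫₀¹ u' v̄' dρ` on `H̃₂`; following Mathlib's convention it is
conjugate linear in its first argument, so that `inner u v` is `(v|u)₂`. -/
@[reducible] noncomputable def core2 : InnerProductSpace.Core ℂ H2t where
  inner u v := ∫ ρ in (0 : ℝ)..1, conj (D u.fn ρ) * D v.fn ρ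
  conj_inner_symm u v := by
    simp only [intervalIntegral.integral_of_le zero_le_one]
    rw [← integral_conj]
    congr 1; funext ρ
    simp [mul_comm]
  re_inner_nonneg u := by
    rw [self2]
    exact intervalIntegral.integral_nonneg zero_le_one fun ρ _ => by positivity
  add_left u v w := by
    rw [← intervalIntegral.integral_add (integrable2 u w) (integrable2 v w)]
    refine intervalIntegral.integral_congr fun ρ hρ => ?_
    rw [uIcc_of_le zero_le_one] at hρ
    simp only [map_add]
    rw [D_add (n := 1) (by norm_num) u.mem.1.1 v.mem.1.1 hρ, map_add]
    ring
  smul_left u v c := by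
    rw [← intervalIntegral.integral_const_mul]
    refine intervalIntegral.integral_congr fun ρ hρ => ?_
    rw [uIcc_of_le zero_le_one] at hρ
    simp only [map_smul]
    rw [D_smul (n := 1) (by norm_num) c u.mem.1.1 hρ, map_mul]
    ring
  definite u h := by
    rw [self2] at h
    have h' := Complex.ofReal_eq_zero.1 h
    rw [intervalIntegral.integral_eq_zero_iff_of_le_of_nonneg_ae zero_le_one
      (ae_of_all _ fun ρ => by positivity) (integrable2_self u)] at h'
    refine H2t.fn_injective (eq_zero_of_D_ae (n := 1) (by norm_num) u.mem.1 u.mem.2 ?_)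
    filter_upwards [h'] with ρ h1
    simpa using h1

noncomputable instance : NormedAddCommGroup H1t := core1.toNormedAddCommGroup
noncomputable instance : InnerProductSpace ℂ H1t := InnerProductSpace.ofCore core1.toCore
noncomputable instance : NormedAddCommGroup H2t := core2.toNormedAddCommGroup
noncomputable instance : InnerProductSpace ℂ H2t := InnerProductSpace.ofCore core2.toCore

/-- The pre-Hilbert space `H̃ = H̃₁ × H̃₂` with the inner product `(u₁|v₁)₁ + (u₂|v₂)₂`. -/
abbrev Ht : Type := WithLp 2 (H1t × H2t)

/-- The Hilbert space `H = H₁ × H₂`, the completion of `H̃`. -/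
noncomputable abbrev H : Type := UniformSpace.Completion Ht


/-- The potential `V₁(ρ) = -16 / (1 + ρ²)²`. -/
noncomputable def V₁ (ρ : ℝ) : ℝ := -16 / (1 + ρ ^ 2) ^ 2

/-- `V₁(ρ) = (2 cos(2 f₀(ρ)) - 2) / ρ²`, where `f₀(ρ) = 2 arctan ρ` is the ground state. -/
theorem V₁_eq {ρ : ℝ} (hρ : ρ ≠ 0) :
    V₁ ρ = (2 * Real.cos (2 * (2 * Real.arctan ρ)) - 2) / ρ ^ 2 := by
  have h : (1 + ρ ^ 2) ≠ 0 := by positivity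
  rw [V₁, Real.cos_two_mul, Real.cos_two_mul, Real.cos_sq_arctan]
  field_simp
  ring

/-- `(K u)(ρ) = ∫₀^ρ ρ' u(ρ') dρ'`. -/
noncomputable def K (u : ℝ → ℂ) (ρ : ℝ) : ℂ := ∫ r in (0 : ℝ)..ρ, (r : ℂ) * u r

/-- The first component of the differential expression `L̃₀ u`. -/
noncomputable def l01 (u₁ u₂ : ℝ → ℂ) : ℝ → ℂ :=
  I.indicator fun ρ => -ρ * D u₁ ρ + u₁ ρ + ρ * D u₂ ρ - u₂ ρ

/-- The second component of the differential expression `L̃₀ u`. On the domain below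
`u₁'(ρ) / ρ → u₁''(0) = 0` as `ρ → 0`, which agrees with the value of the quotient at `ρ = 0`. -/
noncomputable def l02 (u₁ u₂ : ℝ → ℂ) : ℝ → ℂ :=
  I.indicator fun ρ => D u₁ ρ / ρ - ρ * D u₂ ρ

/-- The first component `-V₁(ρ) ∫₀^ρ ρ' u₂(ρ') dρ'` of `L' u`. -/
noncomputable def lp1 (u₂ : ℝ → ℂ) : ℝ → ℂ :=
  I.indicator fun ρ => -V₁ ρ * K u₂ ρ

theorem mem_Ck_indicator {k : ℕ} {f : ℝ → ℂ} (hf : ContDiffOn ℝ k f I) :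
    I.indicator f ∈ Ck k :=
  ⟨hf.congr fun _ hx => indicator_of_mem hx f, fun _ hx => indicator_of_notMem hx f⟩

theorem D_indicator {f : ℝ → ℂ} {ρ : ℝ} (hρ : ρ ∈ I) : D (I.indicator f) ρ = D f ρ :=
  D_congr (fun _ hx => indicator_of_mem hx f) hρ

theorem contDiffOn_id' {n : ℕ} : ContDiffOn ℝ n (fun ρ : ℝ => (ρ : ℂ)) I :=
  Complex.ofRealCLM.contDiff.contDiffOn

theorem hasD_id {ρ : ℝ} : HasDerivWithinAt (fun ρ : ℝ => (ρ : ℂ)) 1 I ρ :=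
  Complex.ofRealCLM.hasDerivAt.hasDerivWithinAt

theorem l01_mem {u₁ u₂ : ℝ → ℂ} (h1 : u₁ ∈ Ck 3) (h10 : u₁ 0 = 0) (h2 : u₂ ∈ Ck 3)
    (h20 : u₂ 0 = 0) : l01 u₁ u₂ ∈ preH1 := by
  refine ⟨mem_Ck_indicator ?_, ?_, ?_⟩
  · have a1 := contDiffOn_D h1.1 (m := 2) (by norm_num)
    have a2 := contDiffOn_D h2.1 (m := 2) (by norm_num)
    have b1 := h1.1.of_le (m := (2 : ℕ)) (by norm_cast)
    have b2 := h2.1.of_le (m := (2 : ℕ)) (by norm_cast)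
    exact (((contDiffOn_id'.neg.mul a1).add b1).add (contDiffOn_id'.mul a2)).sub b2
  · simp [l01, h10, h20]
  · rw [l01, D_indicator zero_mem_I]
    have a1 := hasD (contDiffOn_D h1.1 (m := 2) (by norm_num)) (by norm_num) zero_mem_I
    have a2 := hasD (contDiffOn_D h2.1 (m := 2) (by norm_num)) (by norm_num) zero_mem_I
    have b1 := hasD h1.1 (by norm_num) zero_mem_I
    have b2 := hasD h2.1 (by norm_num) zero_mem_I
    refine D_eq zero_mem_I
      (((((hasD_id (ρ := 0)).neg.mul a1).add b1).add (hasD_id.mul a2)).sub b2 |>.congr_deriv ?_)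
    simp

/-- If `g ∈ C²[0,1]` and `g(0) = g'(0) = 0`, then `g(ρ)/ρ` is in `C¹[0,1]`. -/
theorem contDiffOn_div {g : ℝ → ℂ} (hg : ContDiffOn ℝ (2 : ℕ) g I) (h0 : g 0 = 0)
    (h1 : D g 0 = 0) : ContDiffOn ℝ (1 : ℕ) (fun ρ : ℝ => g ρ / ρ) I := by
  have hDg := contDiffOn_D hg (m := 1) (by norm_num)
  have hDDc : ContinuousOn (D (D g)) I := (contDiffOn_D hDg (m := 0) (by norm_num)).continuousOn
  set c : ℂ := D (D g) 0 with hc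
  set k : ℝ → ℂ := fun ρ => if ρ = 0 then c / 2 else (D g ρ * ρ - g ρ * 1) / (ρ : ℂ) ^ 2 with hk
  have key : ∀ ε > 0, ∃ δ > 0, ∀ ρ ∈ I, ρ < δ →
      ‖D g ρ - c * ρ‖ ≤ ε * ρ ∧ ‖g ρ - c * (ρ : ℂ) ^ 2 / 2‖ ≤ ε * ρ ^ 2 := by
    intro ε hε
    have h2 := (hasD hDg le_rfl zero_mem_I).isLittleO.def hε
    obtain ⟨δ, hδ, hb⟩ := Metric.mem_nhdsWithin_iff.1 h2
    have hb' : ∀ ρ ∈ I, ρ < δ → ‖D g ρ - c * ρ‖ ≤ ε * ρ := by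
      intro ρ hρ hlt
      have := hb ⟨by simpa [abs_of_nonneg hρ.1] using hlt, hρ⟩
      simpa [h1, abs_of_nonneg hρ.1, mul_comm] using this
    refine ⟨δ, hδ, fun ρ hρ hlt => ⟨hb' ρ hρ hlt, ?_⟩⟩
    have hsub : Icc 0 ρ ⊆ I := Icc_subset_Icc_right hρ.2
    have hder : ∀ x ∈ Icc 0 ρ,
        HasDerivWithinAt (fun x : ℝ => g x - c * (x : ℂ) ^ 2 / 2) (D g x - c * x) (Icc 0 ρ) x := by
      intro x hx
      have e1 := (hasD hg (by norm_num) (hsub hx)).mono hsub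
      have e2 := (((hasD_id (ρ := x)).mono hsub).pow 2).const_mul c |>.div_const 2
      refine (e1.sub e2).congr_deriv ?_
      push_cast
      ring
    have hbd : ∀ x ∈ Icc 0 ρ, ‖D g x - c * x‖ ≤ ε * ρ := fun x hx =>
      (hb' x (hsub hx) (hx.2.trans_lt hlt)).trans (by gcongr; exact hx.2)
    have := (convex_Icc (0 : ℝ) ρ).norm_image_sub_le_of_norm_hasDerivWithin_le hder hbd
      (left_mem_Icc.2 hρ.1) (right_mem_Icc.2 hρ.1)
    simp only [h0, Complex.ofReal_zero, sub_zero, Real.norm_eq_abs, abs_of_nonneg hρ.1] at this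
    calc _ ≤ _ := by simpa using this
      _ = _ := by ring
  have hder : ∀ ρ ∈ I, HasDerivWithinAt (fun ρ : ℝ => g ρ / ρ) (k ρ) I ρ := by
    intro ρ hρ
    by_cases h : ρ = 0
    · subst h
      rw [hasDerivWithinAt_iff_isLittleO, Asymptotics.isLittleO_iff]
      intro ε hε
      obtain ⟨δ, hδ, hb⟩ := key ε hε
      refine Metric.mem_nhdsWithin_iff.2 ⟨δ, hδ, ?_⟩
      rintro x ⟨hx1, hx⟩
      have hlt : x < δ := by simpa [abs_of_nonneg hx.1] using hx1
      rcases hx.1.eq_or_lt with h | h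
      · simp [← h]
      have hx0 : (x : ℂ) ≠ 0 := by exact_mod_cast h.ne'
      have e : g x / x - g 0 / ((0 : ℝ) : ℂ) - (x - 0) • k 0 =
          (g x - c * (x : ℂ) ^ 2 / 2) / x := by
        simp only [hk, if_true, h0, Complex.real_smul]
        push_cast
        field_simp
        ring
      simp only [mem_ofPred_eq]
      rw [e, norm_div, Complex.norm_real, Real.norm_eq_abs, abs_of_pos h, div_le_iff₀ h, sub_zero,
        Real.norm_eq_abs, abs_of_pos h]
      exact ((hb x hx hlt).2).trans_eq (by ring)
    · have hx0 : (ρ : ℂ) ≠ 0 := by exact_mod_cast h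
      have := (hasD hg (by norm_num) hρ).div hasD_id hx0
      simp only [hk, h, if_false]
      exact this
  have hkc : ContinuousOn k I := by
    intro ρ hρ
    by_cases h : ρ = 0
    · subst h
      rw [Metric.continuousWithinAt_iff]
      intro ε hε
      obtain ⟨δ, hδ, hb⟩ := key (ε / 3) (by positivity)
      refine ⟨δ, hδ, fun {x} hx hx1 => ?_⟩
      have hlt : x < δ := by simpa [abs_of_nonneg hx.1] using hx1
      rcases hx.1.eq_or_lt with h | h
      · simpa [← h] using hε
      have hx0 : (x : ℂ) ≠ 0 := by exact_mod_cast h.ne'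
      have e : k x - k 0 =
          ((D g x - c * x) * x - (g x - c * (x : ℂ) ^ 2 / 2)) / (x : ℂ) ^ 2 := by
        simp only [hk, if_true, h.ne', if_false]
        field_simp
        ring
      rw [dist_eq_norm, e, norm_div, norm_pow, Complex.norm_real, Real.norm_eq_abs,
        abs_of_pos h, div_lt_iff₀ (by positivity)]
      obtain ⟨b1, b2⟩ := hb x hx hlt
      calc _ ≤ ‖D g x - c * x‖ * x + ‖g x - c * (x : ℂ) ^ 2 / 2‖ := by
            refine (norm_sub_le _ _).trans_eq ?_
            rw [norm_mul, Complex.norm_real, Real.norm_eq_abs, abs_of_pos h]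
        _ ≤ ε / 3 * x * x + ε / 3 * x ^ 2 := by gcongr
        _ < ε * x ^ 2 := by nlinarith [mul_pos hε (pow_pos h 2)]
    · have hx0 : (ρ : ℂ) ≠ 0 := by exact_mod_cast h
      have hcont : ContinuousWithinAt
          (fun ρ : ℝ => (D g ρ * ρ - g ρ * 1) / (ρ : ℂ) ^ 2) I ρ := by
        refine ContinuousWithinAt.div ?_ (by fun_prop) (pow_ne_zero 2 hx0)
        exact ((hDg.continuousOn ρ hρ).mul
          Complex.continuous_ofReal.continuousWithinAt).sub ((hg.continuousOn ρ hρ).mul_const 1)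
      refine hcont.congr_of_eventuallyEq ?_ (by simp [hk, h])
      filter_upwards [mem_nhdsWithin_of_mem_nhds (isOpen_ne.mem_nhds h)] with x hx
      have hx' : x ≠ 0 := hx
      simp [hk, hx']
  rw [show ((1 : ℕ) : WithTop ℕ∞) = 1 by norm_num, contDiffOn_one_iff_derivWithin uniqueDiff]
  exact ⟨fun ρ hρ => (hder ρ hρ).differentiableWithinAt,
    hkc.congr fun ρ hρ => D_eq hρ (hder ρ hρ)⟩

theorem l02_mem {u₁ u₂ : ℝ → ℂ} (h1 : u₁ ∈ Ck 3) (h1' : D u₁ 0 = 0)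
    (h1'' : D (D u₁) 0 = 0) (h2 : u₂ ∈ Ck 3) : l02 u₁ u₂ ∈ preH2 := by
  refine ⟨mem_Ck_indicator ?_, ?_⟩
  · exact (contDiffOn_div (contDiffOn_D h1.1 (m := 2) (by norm_num)) h1' h1'').sub
      (contDiffOn_id'.mul (contDiffOn_D h2.1 (m := 1) (by norm_num)))
  · simp [l02, h1']

theorem hasD_K {u : ℝ → ℂ} (hu : ContinuousOn u I) {ρ : ℝ} (hρ : ρ ∈ I) :
    HasDerivWithinAt (K u) (ρ * u ρ) I ρ := by
  have hc : ContinuousOn (fun r : ℝ => (r : ℂ) * u r) I :=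
    Complex.continuous_ofReal.continuousOn.mul hu
  have : Fact (ρ ∈ Icc (0 : ℝ) 1) := ⟨hρ⟩
  exact intervalIntegral.integral_hasDerivWithinAt_right
    ((hc.mono (Icc_subset_Icc_right hρ.2)).intervalIntegrable_of_Icc hρ.1)
    (hc.stronglyMeasurableAtFilter_nhdsWithin measurableSet_Icc ρ) (hc ρ hρ)

theorem contDiffOn_K {u : ℝ → ℂ} (hu : ContDiffOn ℝ (1 : ℕ) u I) :
    ContDiffOn ℝ (2 : ℕ) (K u) I := by
  have h := fun ρ (hρ : ρ ∈ I) => hasD_K hu.continuousOn hρ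
  rw [show ((2 : ℕ) : WithTop ℕ∞) = ((1 : ℕ) : WithTop ℕ∞) + 1 by norm_num,
    contDiffOn_succ_iff_derivWithin uniqueDiff]
  refine ⟨fun ρ hρ => (h ρ hρ).differentiableWithinAt, by simp, ?_⟩
  exact (contDiffOn_id'.mul hu).congr fun ρ hρ => D_eq hρ (h ρ hρ)

theorem contDiff_V₁_real {n : ℕ} : ContDiff ℝ n V₁ :=
  contDiff_const.div (by fun_prop) fun x => by positivity

theorem contDiff_V₁ {n : ℕ} : ContDiff ℝ n (fun ρ => ((V₁ ρ : ℝ) : ℂ)) := by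
  exact Complex.ofRealCLM.contDiff.comp contDiff_V₁_real

theorem lp1_hasD {u : ℝ → ℂ} (hu : ContinuousOn u I) {ρ : ℝ} (hρ : ρ ∈ I) :
    D (lp1 u) ρ = -((deriv V₁ ρ : ℝ) : ℂ) * K u ρ + -V₁ ρ * (ρ * u ρ) := by
  rw [lp1, D_indicator hρ]
  have h1 : HasDerivAt V₁ (deriv V₁ ρ) ρ :=
    ((contDiff_V₁_real (n := 1)).differentiable (by norm_num) ρ).hasDerivAt
  exact D_eq hρ (h1.ofReal_comp.neg.hasDerivWithinAt.mul (hasD_K hu hρ))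

theorem lp1_mem {u : ℝ → ℂ} (hu : u ∈ preH2) : lp1 u ∈ preH1 := by
  refine ⟨mem_Ck_indicator ?_, ?_, ?_⟩
  · exact contDiff_V₁.contDiffOn.neg.mul (contDiffOn_K hu.1.1)
  · simp [lp1, K]
  · rw [lp1_hasD hu.1.1.continuousOn zero_mem_I]
    simp [K]

/-- The domain `{u ∈ C³[0,1] : u(0) = u'(0) = u''(0) = 0} × {u ∈ C³[0,1] : u(0) = 0}` of `L̃₀`,
as a subspace of `H̃`. -/
noncomputable def domL0t : Submodule ℂ Ht where
  carrier := {u | (u.fst.fn ∈ Ck 3 ∧ u.fst.fn 0 = 0 ∧ D u.fst.fn 0 = 0 ∧ D (D u.fst.fn) 0 = 0) ∧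
    u.snd.fn ∈ Ck 3 ∧ u.snd.fn 0 = 0}
  add_mem' := by
    rintro u v ⟨⟨a1, a2, a3, a4⟩, a5, a6⟩ ⟨⟨b1, b2, b3, b4⟩, b5, b6⟩
    refine ⟨⟨?_, ?_, ?_, ?_⟩, ?_, ?_⟩
    · simpa using add_mem a1 b1
    · simp [a2, b2]
    · simp only [WithLp.add_fst, map_add]
      rw [D_add (by norm_num) a1.1 b1.1 zero_mem_I, a3, b3, add_zero]
    · simp only [WithLp.add_fst, map_add]
      rw [D_congr (fun ρ hρ => D_add (by norm_num) a1.1 b1.1 hρ) zero_mem_I]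
      exact (D_add (n := 2) (by norm_num) (contDiffOn_D a1.1 (by norm_num))
        (contDiffOn_D b1.1 (by norm_num)) zero_mem_I).trans (by rw [a4, b4, add_zero])
    · simpa using add_mem a5 b5
    · simp [a6, b6]
  zero_mem' := by
    have h : D (0 : ℝ → ℂ) = 0 := by funext x; simp [D]
    simp [h]
  smul_mem' := by
    rintro c u ⟨⟨a1, a2, a3, a4⟩, a5, a6⟩
    refine ⟨⟨?_, ?_, ?_, ?_⟩, ?_, ?_⟩
    · simpa using Submodule.smul_mem _ c a1
    · simp [a2]
    · simp only [WithLp.smul_fst, map_smul]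
      rw [D_smul (by norm_num) c a1.1 zero_mem_I, a3, mul_zero]
    · simp only [WithLp.smul_fst, map_smul]
      rw [D_congr (v := c • D u.fst.fn) (fun ρ hρ => D_smul (by norm_num) c a1.1 hρ) zero_mem_I]
      rw [D_smul (n := 2) (by norm_num) c (contDiffOn_D a1.1 (by norm_num)) zero_mem_I, a4,
        mul_zero]
    · simpa using Submodule.smul_mem _ c a5
    · simp [a6]

theorem l01_add {u₁ u₂ v₁ v₂ : ℝ → ℂ} (h1 : u₁ ∈ Ck 3) (h2 : u₂ ∈ Ck 3) (k1 : v₁ ∈ Ck 3)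
    (k2 : v₂ ∈ Ck 3) : l01 (u₁ + v₁) (u₂ + v₂) = l01 u₁ u₂ + l01 v₁ v₂ := by
  funext ρ
  by_cases hρ : ρ ∈ I
  · simp only [l01, Pi.add_apply, indicator_of_mem hρ]
    rw [D_add (by norm_num) h1.1 k1.1 hρ, D_add (by norm_num) h2.1 k2.1 hρ]
    ring
  · simp [l01, indicator_of_notMem hρ]

theorem l02_add {u₁ u₂ v₁ v₂ : ℝ → ℂ} (h1 : u₁ ∈ Ck 3) (h2 : u₂ ∈ Ck 3) (k1 : v₁ ∈ Ck 3)
    (k2 : v₂ ∈ Ck 3) : l02 (u₁ + v₁) (u₂ + v₂) = l02 u₁ u₂ + l02 v₁ v₂ := by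
  funext ρ
  by_cases hρ : ρ ∈ I
  · simp only [l02, Pi.add_apply, indicator_of_mem hρ]
    rw [D_add (by norm_num) h1.1 k1.1 hρ, D_add (by norm_num) h2.1 k2.1 hρ]
    ring
  · simp [l02, indicator_of_notMem hρ]

theorem l01_smul (c : ℂ) {u₁ u₂ : ℝ → ℂ} (h1 : u₁ ∈ Ck 3) (h2 : u₂ ∈ Ck 3) :
    l01 (c • u₁) (c • u₂) = c • l01 u₁ u₂ := by
  funext ρ
  by_cases hρ : ρ ∈ I
  · simp only [l01, Pi.smul_apply, indicator_of_mem hρ, smul_eq_mul]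
    rw [D_smul (by norm_num) c h1.1 hρ, D_smul (by norm_num) c h2.1 hρ]
    ring
  · simp [l01, indicator_of_notMem hρ]

theorem l02_smul (c : ℂ) {u₁ u₂ : ℝ → ℂ} (h1 : u₁ ∈ Ck 3) (h2 : u₂ ∈ Ck 3) :
    l02 (c • u₁) (c • u₂) = c • l02 u₁ u₂ := by
  funext ρ
  by_cases hρ : ρ ∈ I
  · simp only [l02, Pi.smul_apply, indicator_of_mem hρ, smul_eq_mul]
    rw [D_smul (by norm_num) c h1.1 hρ, D_smul (by norm_num) c h2.1 hρ]
    ring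
  · simp [l02, indicator_of_notMem hρ]

theorem intervalIntegrable_K {u : ℝ → ℂ} (hu : ContinuousOn u I) {ρ : ℝ} (hρ : ρ ∈ I) :
    IntervalIntegrable (fun r : ℝ => (r : ℂ) * u r) volume 0 ρ :=
  ((Complex.continuous_ofReal.continuousOn.mul hu).mono
    (Icc_subset_Icc_right hρ.2)).intervalIntegrable_of_Icc hρ.1

theorem lp1_add {u v : ℝ → ℂ} (hu : u ∈ preH2) (hv : v ∈ preH2) :
    lp1 (u + v) = lp1 u + lp1 v := by
  funext ρ
  by_cases hρ : ρ ∈ I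
  · have h : K (u + v) ρ = K u ρ + K v ρ := by
      simp only [K, Pi.add_apply, mul_add]
      exact intervalIntegral.integral_add (intervalIntegrable_K hu.1.1.continuousOn hρ)
        (intervalIntegrable_K hv.1.1.continuousOn hρ)
    simp only [lp1, Pi.add_apply, indicator_of_mem hρ]
    rw [h]
    ring
  · simp [lp1, indicator_of_notMem hρ]

theorem lp1_smul (c : ℂ) (u : ℝ → ℂ) : lp1 (c • u) = c • lp1 u := by
  have h : ∀ ρ, K (c • u) ρ = c * K u ρ := fun ρ => by
    simp only [K, Pi.smul_apply, smul_eq_mul, mul_left_comm _ c]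
    exact intervalIntegral.integral_const_mul _ _
  funext ρ
  by_cases hρ : ρ ∈ I
  · simp only [lp1, Pi.smul_apply, indicator_of_mem hρ, smul_eq_mul]
    rw [h]
    ring
  · simp [lp1, indicator_of_notMem hρ]

/-- A function of `H̃₁`. -/
def H1t.mk (u : ℝ → ℂ) (hu : u ∈ preH1) : H1t := ⟨u, hu⟩

/-- A function of `H̃₂`. -/
def H2t.mk (u : ℝ → ℂ) (hu : u ∈ preH2) : H2t := ⟨u, hu⟩

@[simp] theorem H1t.fn_mk (u : ℝ → ℂ) (hu : u ∈ preH1) : (H1t.mk u hu).fn = u := rfl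

@[simp] theorem H2t.fn_mk (u : ℝ → ℂ) (hu : u ∈ preH2) : (H2t.mk u hu).fn = u := rfl

theorem Ht_ext {u v : Ht} (h1 : u.fst.fn = v.fst.fn) (h2 : u.snd.fn = v.snd.fn) : u = v :=
  WithLp.ofLp_injective 2 (Prod.ext (H1t.fn_injective h1) (H2t.fn_injective h2))

/-- The operator `L̃₀` as a map from its domain to `H̃`. -/
noncomputable def L0fun : domL0t →ₗ[ℂ] Ht where
  toFun u := WithLp.toLp 2
    (H1t.mk (l01 u.1.fst.fn u.1.snd.fn) (l01_mem u.2.1.1 u.2.1.2.1 u.2.2.1 u.2.2.2),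
     H2t.mk (l02 u.1.fst.fn u.1.snd.fn) (l02_mem u.2.1.1 u.2.1.2.2.1 u.2.1.2.2.2 u.2.2.1))
  map_add' u v := Ht_ext (by simpa using l01_add u.2.1.1 u.2.2.1 v.2.1.1 v.2.2.1)
    (by simpa using l02_add u.2.1.1 u.2.2.1 v.2.1.1 v.2.2.1)
  map_smul' c u := Ht_ext (by simpa using l01_smul c u.2.1.1 u.2.2.1)
    (by simpa using l02_smul c u.2.1.1 u.2.2.1)

/-- The dense isometric embedding of `H̃` into its completion. -/
noncomputable abbrev emb : Ht →L[ℂ] H := UniformSpace.Completion.toComplL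

theorem emb_injective : Function.Injective (emb : Ht →ₗ[ℂ] H) :=
  UniformSpace.Completion.coe_injective Ht

/-- `L̃₀` as an unbounded operator in the Hilbert space `H`: its domain is the image of the above
domain under the embedding, and there it maps `emb u` to `emb (L̃₀ u)`. -/
noncomputable def L0t : H →ₗ.[ℂ] H where
  domain := domL0t.map (emb : Ht →ₗ[ℂ] H)
  toFun := (emb : Ht →ₗ[ℂ] H) ∘ₗ L0fun ∘ₗ
    ((Submodule.equivMapOfInjective (emb : Ht →ₗ[ℂ] H) emb_injective domL0t).symm :
      domL0t.map (emb : Ht →ₗ[ℂ] H) →ₗ[ℂ] domL0t)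

theorem L0t_apply (u : domL0t) : L0t ⟨emb u.1, Submodule.mem_map_of_mem u.2⟩ = emb (L0fun u) := by
  exact congrArg (fun x => emb (L0fun x)) ((Submodule.equivMapOfInjective
    (emb : Ht →ₗ[ℂ] H) emb_injective domL0t).symm_apply_apply u)

/-- The free operator `L₀`, the closure of `L̃₀`. -/
noncomputable def L0 : H →ₗ.[ℂ] H := L0t.closure

/-- The operator `L'` on `H̃`. -/
noncomputable def LpFun : Ht →ₗ[ℂ] Ht where
  toFun u := WithLp.toLp 2 (H1t.mk (lp1 u.snd.fn) (lp1_mem u.snd.mem), 0)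
  map_add' u v := Ht_ext (by simpa using lp1_add u.snd.mem v.snd.mem) (by simp)
  map_smul' c u := Ht_ext (by simpa using lp1_smul c u.snd.fn) (by simp)

theorem norm_sq1 (u : H1t) : ‖u‖ ^ 2 = ∫ ρ in (0 : ℝ)..1, ‖D u.fn ρ‖ ^ 2 / ρ ^ 2 := by
  rw [← inner_self_eq_norm_sq (𝕜 := ℂ)]
  exact (congrArg Complex.re (self1 u)).trans (Complex.ofReal_re _)

theorem norm_sq2 (u : H2t) : ‖u‖ ^ 2 = ∫ ρ in (0 : ℝ)..1, ‖D u.fn ρ‖ ^ 2 := by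
  rw [← inner_self_eq_norm_sq (𝕜 := ℂ)]
  exact (congrArg Complex.re (self2 u)).trans (Complex.ofReal_re _)

theorem norm_le2 (u : H2t) {ρ : ℝ} (hρ : ρ ∈ I) : ‖u.fn ρ‖ ≤ ‖u‖ := by
  have hsub : Icc 0 ρ ⊆ I := Icc_subset_Icc_right hρ.2
  have hn : IntervalIntegrable (fun x => ‖D u.fn x‖) volume 0 1 :=
    (contOn_D2 u).norm.intervalIntegrable_of_Icc zero_le_one
  have h1 : ∫ x in (0 : ℝ)..ρ, D u.fn x = u.fn ρ - u.fn 0 := by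
    refine intervalIntegral.integral_eq_sub_of_hasDerivAt_of_le hρ.1
      (u.mem.1.1.continuousOn.mono hsub) (fun x hx => ?_)
      (((contOn_D2 u).mono hsub).intervalIntegrable_of_Icc hρ.1)
    have hx' : x ∈ Ioo (0 : ℝ) 1 := ⟨hx.1, hx.2.trans_le hρ.2⟩
    exact (hasD u.mem.1.1 le_rfl (Ioo_subset_Icc_self hx')).hasDerivAt (Icc_mem_nhds hx'.1 hx'.2)
  rw [u.mem.2, sub_zero] at h1
  set m := ∫ x in (0 : ℝ)..1, ‖D u.fn x‖ with hm
  have h2 : ‖u.fn ρ‖ ≤ m := by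
    rw [← h1]
    exact (intervalIntegral.norm_integral_le_integral_norm hρ.1).trans
      (intervalIntegral.integral_mono_interval le_rfl hρ.1 hρ.2
        (ae_of_all _ fun x => norm_nonneg _) hn)
  have h3 : m ^ 2 ≤ ‖u‖ ^ 2 := by
    have h4 : 0 ≤ ∫ x in (0 : ℝ)..1, (‖D u.fn x‖ - m) ^ 2 :=
      intervalIntegral.integral_nonneg zero_le_one fun x _ => sq_nonneg _
    have h5 : ∫ x in (0 : ℝ)..1, (‖D u.fn x‖ - m) ^ 2 = ‖u‖ ^ 2 - m ^ 2 := by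
      have : ∀ x, (‖D u.fn x‖ - m) ^ 2 = ‖D u.fn x‖ ^ 2 - (2 * m * ‖D u.fn x‖ - m ^ 2) :=
        fun x => by ring
      simp only [this]
      rw [intervalIntegral.integral_sub (integrable2_self u) ((hn.const_mul _).sub (by simp)),
        intervalIntegral.integral_sub (hn.const_mul _) (by simp),
        intervalIntegral.integral_const_mul, ← hm, ← norm_sq2]
      simp
      ring
    linarith
  exact h2.trans (abs_le_of_sq_le_sq' h3 (norm_nonneg _)).2

theorem norm_K_le (u : H2t) {ρ : ℝ} (hρ : ρ ∈ I) : ‖K u.fn ρ‖ ≤ ‖u‖ * ρ := by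
  have := intervalIntegral.norm_integral_le_of_norm_le_const (a := 0) (b := ρ) (C := ‖u‖)
    (f := fun r : ℝ => (r : ℂ) * u.fn r) ?_
  · simpa [K, abs_of_nonneg hρ.1] using this
  · intro x hx
    rw [uIoc_of_le hρ.1] at hx
    have hx' : x ∈ I := ⟨hx.1.le, hx.2.trans hρ.2⟩
    rw [norm_mul, Complex.norm_real, Real.norm_eq_abs, abs_of_nonneg hx'.1]
    calc x * ‖u.fn x‖ ≤ 1 * ‖u‖ := by
          gcongr
          · exact hx'.2
          · exact norm_le2 u hx'
      _ = ‖u‖ := one_mul _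

theorem LpFun_bounded : ∃ C : ℝ, ∀ u, ‖LpFun u‖ ≤ C * ‖u‖ := by
  obtain ⟨A, hA⟩ := (isCompact_Icc (a := (0 : ℝ)) (b := 1)).exists_bound_of_continuousOn
    ((contDiff_V₁_real (n := 1)).continuous_deriv (by norm_num)).continuousOn
  obtain ⟨B, hB⟩ := (isCompact_Icc (a := (0 : ℝ)) (b := 1)).exists_bound_of_continuousOn
    (contDiff_V₁_real (n := 1)).continuous.continuousOn
  have hA0 : 0 ≤ A := (norm_nonneg _).trans (hA 0 zero_mem_I)
  have hB0 : 0 ≤ B := (norm_nonneg _).trans (hB 0 zero_mem_I)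
  refine ⟨A + B, fun u => ?_⟩
  set w : H1t := H1t.mk (lp1 u.snd.fn) (lp1_mem u.snd.mem) with hw
  have hu : ‖u.snd‖ ≤ ‖u‖ := by
    have := WithLp.prod_norm_sq_eq_of_L2 u
    exact (abs_le_of_sq_le_sq' (by nlinarith [sq_nonneg ‖u.fst‖]) (norm_nonneg _)).2
  have h1 : ‖LpFun u‖ = ‖w‖ := by
    have := WithLp.prod_norm_sq_eq_of_L2 (LpFun u)
    have e : ‖LpFun u‖ ^ 2 = ‖w‖ ^ 2 := by
      rw [this]; simp [LpFun, hw]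
    exact (sq_eq_sq₀ (norm_nonneg _) (norm_nonneg _)).1 e
  have h2 : ‖w‖ ^ 2 ≤ ((A + B) * ‖u.snd‖) ^ 2 := by
    rw [norm_sq1]
    calc _ ≤ ∫ _ in (0 : ℝ)..1, ((A + B) * ‖u.snd‖) ^ 2 := by
          refine intervalIntegral.integral_mono_on zero_le_one (integrable1_self w) (by simp) ?_
          intro x hx
          rcases hx.1.eq_or_lt with h | h
          · rw [← h]; simp; positivity
          rw [div_le_iff₀ (by positivity), ← mul_pow]
          refine pow_le_pow_left₀ (norm_nonneg _) ?_ 2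
          rw [hw, H1t.fn_mk, lp1_hasD u.snd.mem.1.1.continuousOn hx]
          refine (norm_add_le _ _).trans ?_
          simp only [norm_mul, norm_neg, Complex.norm_real]
          have k1 := norm_K_le u.snd hx
          have k2 := norm_le2 u.snd hx
          have k3 := hA x hx
          have k4 := hB x hx
          calc _ ≤ A * (‖u.snd‖ * x) + B * (x * ‖u.snd‖) := by
                rw [Real.norm_eq_abs x, abs_of_pos h]
                gcongr
            _ = _ := by ring
      _ = _ := by simp
  rw [h1]
  calc ‖w‖ ≤ (A + B) * ‖u.snd‖ := (abs_le_of_sq_le_sq' h2 (by positivity)).2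
    _ ≤ (A + B) * ‖u‖ := by gcongr

/-- The bounded operator `L'` on `H`, the unique continuous extension. -/
noncomputable def Lp : H →L[ℂ] H :=
  (emb.comp (LpFun.mkContinuousOfExistsBound LpFun_bounded)).extend emb

theorem Lp_emb (u : Ht) : Lp (emb u) = emb (LpFun u) :=
  ContinuousLinearMap.extend_eq _ UniformSpace.Completion.denseRange_coe
    (UniformSpace.Completion.isUniformInducing_coe Ht) u

/-- The operator `L = L₀ + L'`, with the domain of `L₀`. -/
noncomputable def L : H →ₗ.[ℂ] H := (Lp : H →ₗ[ℂ] H) +ᵥ L0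

/-- `R` is the resolvent of the unbounded operator `A` at `z`: a bounded two-sided inverse of
`z - A : 𝒟(A) → E`. -/
def IsResolventAt {E : Type*} [NormedAddCommGroup E] [NormedSpace ℂ E] (A : E →ₗ.[ℂ] E) (z : ℂ)
    (R : E →L[ℂ] E) : Prop :=
  (∀ f : E, ∃ u : A.domain, (u : E) = R f ∧ z • (u : E) - A u = f) ∧
    ∀ u : A.domain, R (z • (u : E) - A u) = u

/-- The resolvent set `ρ(A)`. -/
def opResolventSet {E : Type*} [NormedAddCommGroup E] [NormedSpace ℂ E] (A : E →ₗ.[ℂ] E) : Set ℂ :=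
  {z | ∃ R : E →L[ℂ] E, IsResolventAt A z R}

/-- The spectrum `σ(A)`, the complement of the resolvent set. -/
def opSpectrum {E : Type*} [NormedAddCommGroup E] [NormedSpace ℂ E] (A : E →ₗ.[ℂ] E) : Set ℂ :=
  (opResolventSet A)ᶜ

/-- The point spectrum `σ_p(A)`, the set of all eigenvalues. -/
def opPointSpectrum {E : Type*} [NormedAddCommGroup E] [NormedSpace ℂ E] (A : E →ₗ.[ℂ] E) : Set ℂ :=
  {z | ∃ u : A.domain, (u : E) ≠ 0 ∧ A u = z • (u : E)}

open Classical in
/-- The resolvent `R_A(z) = (z - A)⁻¹` for `z ∈ ρ(A)` (and `0` for other `z`). -/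
noncomputable def opResolvent {E : Type*} [NormedAddCommGroup E] [NormedSpace ℂ E]
    (A : E →ₗ.[ℂ] E) (z : ℂ) : E →L[ℂ] E :=
  if h : z ∈ opResolventSet A then h.choose else 0

theorem IsResolventAt.unique {E : Type*} [NormedAddCommGroup E] [NormedSpace ℂ E]
    {A : E →ₗ.[ℂ] E} {z : ℂ} {R S : E →L[ℂ] E} (hR : IsResolventAt A z R)
    (hS : IsResolventAt A z S) : R = S := by
  ext f
  obtain ⟨u, hu, hf⟩ := hR.1 f
  rw [← hu, ← hS.2 u, hf]

theorem isResolventAt_opResolvent {E : Type*} [NormedAddCommGroup E] [NormedSpace ℂ E]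
    {A : E →ₗ.[ℂ] E} {z : ℂ} (h : z ∈ opResolventSet A) : IsResolventAt A z (opResolvent A z) := by
  rw [opResolvent, dif_pos h]
  exact h.choose_spec

end WaveMap

/-! Write `a = u₁'/ρ` and `b = u₂'`. In these coordinates the norm of `H̃` is the `L²(0,1)` norm of
`(a, b)`, and `L̃₀` becomes the first-order system `(a, b) ↦ (-a - ρa' + b', a' - b - ρb')`. Two
facts about this system, together with one smoothing identity, give the theorem.

Dissipativity: `Re (L̃₀u|u) + ½‖u‖²` is the integral of a total derivative. Its boundary term
vanishes at `0`, since `a(0) = 0` on the domain, and equals `-½|a(1) - b(1)|²` at `1`. Hence `Re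
(L̃₀u|u) ≤ -½‖u‖²` (`re_inner_L0fun_le`). Range: `p = a + b` and `q = a - b` decouple the resolvent
equation into two transport equations, solved explicitly for polynomial data, which are dense
(`exists_smul_sub_L0fun_eq_ofPoly`). The Lumer-Phillips argument then gives `‖(z - L₀)⁻¹‖ ≤ 1/(Re z
+ ½)` for `Re z > -½`.

The perturbation `L'` is bounded but not small; what helps is that it contains an integration.
Multiplying the second component of `(z - L̃₀)u = f` by `ρ` and integrating by parts gives `(z - 2)
K u₂ = u₁ - ρ²u₂ + K f₂` (`sub_two_mul_K_eq`), and so `‖L'(z - L₀)⁻¹‖ = O(1/|z - 2|)`, uniformly on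
`Re z ≥ -½ + ε`. For large `|z|` this is at most `½`, and a Neumann series inverts `z - L` with norm
at most `2/ε`. The spectral statements follow from `|Im z| ≤ |z|`. -/

namespace WaveMap

/-! ### Dissipative operators, their closures, and bounded perturbations -/

section Abstract

variable {E : Type*} [NormedAddCommGroup E] [InnerProductSpace ℂ E]

/-- An inequality `Re ⟪x, y⟫ ≤ -w ‖x‖²` on the graph of an operator persists on the closure of the
graph. -/
theorem re_inner_le_of_mem_closure_graph {T : E →ₗ.[ℂ] E} {w : ℝ}
    (hd : ∀ u : T.domain, (⟪(u : E), T u⟫_ℂ).re ≤ -w * ‖(u : E)‖ ^ 2) {x : E × E}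
    (hx : x ∈ T.graph.topologicalClosure) : (⟪x.1, x.2⟫_ℂ).re ≤ -w * ‖x.1‖ ^ 2 := by
  have hc : IsClosed {x : E × E | (⟪x.1, x.2⟫_ℂ).re ≤ -w * ‖x.1‖ ^ 2} :=
    isClosed_le (Complex.continuous_re.comp (continuous_fst.inner continuous_snd))
      (by fun_prop)
  refine closure_minimal (fun y hy => ?_) hc hx
  obtain ⟨u, h1, h2⟩ := (LinearPMap.mem_graph_iff T).1 hy
  simpa only [mem_ofPred_eq, ← h1, ← h2] using hd u

/-- An inequality between a bounded operator `B` and `z - T` persists on the closure of `T`. -/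
theorem norm_mul_le_of_closure {T : E →ₗ.[ℂ] E} (hT : T.IsClosable) {B : E →L[ℂ] E} {z : ℂ}
    {k C : ℝ} (h : ∀ u : T.domain, k * ‖B (u : E)‖ ≤ C * (‖(u : E)‖ + ‖z • (u : E) - T u‖))
    (x : T.closure.domain) :
    k * ‖B (x : E)‖ ≤ C * (‖(x : E)‖ + ‖z • (x : E) - T.closure x‖) := by
  have hc : IsClosed {y : E × E | k * ‖B y.1‖ ≤ C * (‖y.1‖ + ‖z • y.1 - y.2‖)} :=
    isClosed_le (by fun_prop) (by fun_prop)
  have hx : ((x : E), T.closure x) ∈ T.graph.topologicalClosure := by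
    rw [hT.graph_closure_eq_closure_graph]
    exact T.closure.mem_graph x
  refine closure_minimal (fun y hy => ?_) hc hx
  obtain ⟨u, h1, h2⟩ := (LinearPMap.mem_graph_iff T).1 hy
  simpa only [mem_ofPred_eq, ← h1, ← h2] using h u

/-- Let `(0, v)` lie in the closure of the graph. Applying the inequality to `t(u, Tu) + (0, v)`,
dividing by `t > 0` and letting `t → 0` leaves `Re ⟪u, v⟫ ≤ 0` for all `u` in the domain. By density
`u = v` is allowed, so `v = 0`. -/
theorem isClosable_of_re_inner_le {T : E →ₗ.[ℂ] E} {w : ℝ}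
    (hd : ∀ u : T.domain, (⟪(u : E), T u⟫_ℂ).re ≤ -w * ‖(u : E)‖ ^ 2)
    (hdom : Dense (T.domain : Set E)) : T.IsClosable := by
  have key : ∀ x ∈ T.graph.topologicalClosure, x.1 = 0 → x.2 = 0 := by
    rintro ⟨x, v⟩ hx hx0
    simp only at hx0
    subst hx0
    have h1 : ∀ u ∈ T.domain, (⟪u, v⟫_ℂ).re ≤ 0 := by
      intro u hu
      set c : ℝ := -w * ‖u‖ ^ 2 - (⟪u, T ⟨u, hu⟩⟫_ℂ).re
      have h2 : ∀ t : ℝ, 0 < t → (⟪u, v⟫_ℂ).re ≤ t * c := by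
        intro t ht
        have hg : (u, T ⟨u, hu⟩) ∈ T.graph.topologicalClosure :=
          T.graph.le_topologicalClosure (T.mem_graph ⟨u, hu⟩)
        have := re_inner_le_of_mem_closure_graph hd
          (add_mem (Submodule.smul_mem _ (t : ℂ) hg) hx)
        simp only [Prod.smul_mk, Prod.mk_add_mk, add_zero, inner_smul_left, inner_add_right,
          inner_smul_right, Complex.conj_ofReal, norm_smul, Complex.norm_real, Complex.re_ofReal_mul,
          Complex.add_re, Real.norm_eq_abs, mul_pow, sq_abs] at this
        have h3 : t * (⟪u, v⟫_ℂ).re ≤ t * (t * c) := by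
          simp only [c]; nlinarith
        exact le_of_mul_le_mul_left h3 ht
      have h4 : Tendsto (fun t : ℝ => t * c) (𝓝[>] 0) (𝓝 0) := by
        have : Continuous fun t : ℝ => t * c := by fun_prop
        simpa using (this.tendsto 0).mono_left nhdsWithin_le_nhds
      exact ge_of_tendsto h4 (by filter_upwards [self_mem_nhdsWithin] with t ht using h2 t ht)
    have h5 : (⟪v, v⟫_ℂ).re ≤ 0 := by
      have hc : IsClosed {u : E | (⟪u, v⟫_ℂ).re ≤ 0} :=
        isClosed_le (Complex.continuous_re.comp (continuous_id.inner continuous_const))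
          continuous_const
      exact closure_minimal (fun u hu => h1 u hu) hc (hdom v)
    have h6 : ‖v‖ ^ 2 ≤ 0 := by rw [← inner_self_eq_norm_sq (𝕜 := ℂ)]; exact h5
    have : ‖v‖ = 0 := by nlinarith [norm_nonneg v]
    exact norm_eq_zero.1 this
  exact ⟨_, (Submodule.toLinearPMap_graph_eq _ key).symm⟩

/-- Pair `z • x - y` with `x` and use Cauchy-Schwarz. This lower bound yields both injectivity and
the norm of the inverse. -/
theorem norm_le_norm_smul_sub {z : ℂ} {w : ℝ} {x y : E}
    (h : (⟪x, y⟫_ℂ).re ≤ -w * ‖x‖ ^ 2) : (z.re + w) * ‖x‖ ≤ ‖z • x - y‖ := by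
  rcases eq_or_ne x 0 with rfl | hx
  · simp
  have hx' : 0 < ‖x‖ := norm_pos_iff.2 hx
  have h1 : (z.re + w) * ‖x‖ ^ 2 ≤ (⟪x, z • x - y⟫_ℂ).re := by
    have e : ⟪x, x⟫_ℂ = ((‖x‖ ^ 2 : ℝ) : ℂ) := by
      rw [inner_self_eq_norm_sq_to_K]; norm_cast
    rw [inner_sub_right, inner_smul_right, e, Complex.sub_re, Complex.re_mul_ofReal]
    linarith
  have h2 : (⟪x, z • x - y⟫_ℂ).re ≤ ‖x‖ * ‖z • x - y‖ :=
    (Complex.re_le_norm _).trans (norm_inner_le_norm _ _)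
  have h3 : ‖x‖ * ((z.re + w) * ‖x‖) ≤ ‖x‖ * ‖z • x - y‖ := by nlinarith
  exact le_of_mul_le_mul_left h3 hx'

/-- A surjective `z - A` that is bounded below has a bounded inverse. -/
theorem exists_isResolventAt {A : E →ₗ.[ℂ] E} {z : ℂ} {c : ℝ} (hc : 0 < c)
    (hb : ∀ u : A.domain, c * ‖(u : E)‖ ≤ ‖z • (u : E) - A u‖)
    (hs : ∀ f : E, ∃ u : A.domain, z • (u : E) - A u = f) :
    ∃ R : E →L[ℂ] E, IsResolventAt A z R ∧ ‖R‖ ≤ 1 / c := by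
  let S : A.domain →ₗ[ℂ] E := z • A.domain.subtype - A.toFun
  have hS : ∀ u, S u = z • (u : E) - A u := fun u => rfl
  have hinj : Function.Injective S := by
    rw [← LinearMap.ker_eq_bot, LinearMap.ker_eq_bot']
    intro u hu
    have h := hb u
    rw [← hS, hu, norm_zero] at h
    have : ‖(u : E)‖ = 0 := le_antisymm (by nlinarith) (norm_nonneg _)
    exact Subtype.ext (norm_eq_zero.1 this)
  let e := LinearEquiv.ofBijective S ⟨hinj, hs⟩
  let R : E →L[ℂ] E := (A.domain.subtype ∘ₗ (e.symm : E →ₗ[ℂ] A.domain)).mkContinuous (1 / c) (by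
    intro f
    have h := hb (e.symm f)
    rw [← hS, show S (e.symm f) = f from e.apply_symm_apply f] at h
    rw [div_mul_eq_mul_div, one_mul, le_div_iff₀ hc, mul_comm]
    exact h)
  refine ⟨R, ⟨fun f => ⟨e.symm f, rfl, e.apply_symm_apply f⟩, fun u => ?_⟩,
    LinearMap.mkContinuous_norm_le _ (by positivity) _⟩
  exact congrArg Subtype.val (e.symm_apply_apply u)

variable [CompleteSpace E]

/-- The Lumer-Phillips argument: the closure of a densely defined operator with
`Re ⟪u, T u⟫ ≤ -w ‖u‖²` has a resolvent at `z` if `z - T` has dense range. -/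
theorem exists_isResolventAt_closure {T : E →ₗ.[ℂ] E} {w : ℝ}
    (hd : ∀ u : T.domain, (⟪(u : E), T u⟫_ℂ).re ≤ -w * ‖(u : E)‖ ^ 2)
    (hdom : Dense (T.domain : Set E)) {z : ℂ} (hz : 0 < z.re + w)
    (hr : DenseRange fun u : T.domain => z • (u : E) - T u) :
    ∃ R : E →L[ℂ] E, IsResolventAt T.closure z R ∧ ‖R‖ ≤ 1 / (z.re + w) := by
  have hcl := isClosable_of_re_inner_le hd hdom
  have hd' : ∀ u : T.closure.domain, (⟪(u : E), T.closure u⟫_ℂ).re ≤ -w * ‖(u : E)‖ ^ 2 := by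
    intro u
    refine re_inner_le_of_mem_closure_graph hd (x := ((u : E), T.closure u)) ?_
    rw [hcl.graph_closure_eq_closure_graph]
    exact T.closure.mem_graph u
  refine exists_isResolventAt hz (fun u => norm_le_norm_smul_sub (hd' u)) fun f => ?_
  -- The range of `z - T.closure` is closed: if `(z - T)uₙ → f`, the lower bound makes `uₙ` Cauchy,
  -- `T uₙ = z uₙ - (z - T)uₙ` then converges too, and the limit pair lies on the closed graph.
  obtain ⟨s, hs, hlim⟩ := mem_closure_iff_seq_limit.1 (hr f)
  choose u hu using hs
  have hcau : CauchySeq fun n => (u n : E) := by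
    rw [Metric.cauchySeq_iff]
    intro ε hε
    obtain ⟨N, hN⟩ := Metric.cauchySeq_iff.1 hlim.cauchySeq (ε * (z.re + w)) (by positivity)
    refine ⟨N, fun m hm n hn => ?_⟩
    have h1 := norm_le_norm_smul_sub (z := z) (hd (u m - u n))
    have h2 : z • ((u m - u n : T.domain) : E) - T (u m - u n) = s m - s n := by
      rw [← hu m, ← hu n, T.map_sub]; simp only [Submodule.coe_sub, smul_sub]; abel
    have h3 := hN m hm n hn
    rw [h2, ← dist_eq_norm, Submodule.coe_sub, ← dist_eq_norm] at h1
    rw [mul_comm ε] at h3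
    exact lt_of_mul_lt_mul_left (h1.trans_lt h3) hz.le
  obtain ⟨x, hx⟩ := cauchySeq_tendsto_of_complete hcau
  have hT : Tendsto (fun n => T (u n)) atTop (𝓝 (z • x - f)) := by
    refine ((hx.const_smul z).sub hlim).congr fun n => ?_
    rw [← hu n]; simp
  have hmem : (x, z • x - f) ∈ T.closure.graph := by
    rw [← hcl.graph_closure_eq_closure_graph]
    exact mem_closure_of_tendsto (hx.prodMk_nhds hT)
      (Eventually.of_forall fun n => T.mem_graph (u n))
  obtain ⟨v, h1, h2⟩ := (LinearPMap.mem_graph_iff _).1 hmem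
  exact ⟨v, by simp only at h1 h2; rw [h2, h1]; abel⟩

/-- Perturbation of a resolvent by the Neumann series. -/
theorem exists_isResolventAt_vadd {A : E →ₗ.[ℂ] E} {B : E →L[ℂ] E} {z : ℂ} {R : E →L[ℂ] E}
    (hR : IsResolventAt A z R) (hB : ‖B ∘L R‖ ≤ 1 / 2) :
    ∃ S : E →L[ℂ] E, IsResolventAt ((B : E →ₗ[ℂ] E) +ᵥ A) z S ∧ ‖S‖ ≤ 2 * ‖R‖ := by
  -- On the domain of `A` one has `z - (A + B) = (1 - BR)(z - A)`, so the new resolvent is `R(1 -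
  -- BR)⁻¹`.
  have hu : IsUnit (1 - B ∘L R) := isUnit_one_sub_of_norm_lt_one (by linarith)
  obtain ⟨g, hg⟩ := hu
  have hgi : ∀ f : E, (1 - B ∘L R) ((↑g⁻¹ : E →L[ℂ] E) f) = f := fun f => by
    rw [← hg, ← mul_apply_eq_comp, Units.mul_inv]; rfl
  have hig : ∀ f : E, (↑g⁻¹ : E →L[ℂ] E) ((1 - B ∘L R) f) = f := fun f => by
    rw [← hg, ← mul_apply_eq_comp, Units.inv_mul]; rfl
  have hbd : ∀ f : E, ‖(↑g⁻¹ : E →L[ℂ] E) f‖ ≤ 2 * ‖f‖ := fun f => by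
    set h := (↑g⁻¹ : E →L[ℂ] E) f
    have e : h - B (R h) = f := hgi f
    have h1 : ‖B (R h)‖ ≤ 1 / 2 * ‖h‖ :=
      ((B ∘L R).le_opNorm h).trans (mul_le_mul_of_nonneg_right hB (norm_nonneg _))
    have h2 : ‖h‖ ≤ ‖f‖ + ‖B (R h)‖ := by
      have : h = f + B (R h) := by rw [← e]; abel
      exact (congrArg norm this).le.trans (norm_add_le _ _)
    linarith
  refine ⟨R ∘L (↑g⁻¹ : E →L[ℂ] E), ⟨fun f => ?_, fun u => ?_⟩, ?_⟩
  · obtain ⟨u, h1, h2⟩ := hR.1 ((↑g⁻¹ : E →L[ℂ] E) f)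
    refine ⟨u, h1, ?_⟩
    have h3 := hgi f
    simp only [sub_apply, one_apply_eq_self,
      ContinuousLinearMap.comp_apply] at h3
    rw [← h1, ← h2] at h3
    rw [LinearPMap.vadd_apply, ← h3]
    simp only [ContinuousLinearMap.coe_coe]
    abel
  · have h1 := hR.2 u
    have h2 : z • (u : E) - ((B : E →ₗ[ℂ] E) +ᵥ A) u =
        (1 - B ∘L R) (z • (u : E) - A u) := by
      rw [LinearPMap.vadd_apply]
      simp only [sub_apply, one_apply_eq_self,
        ContinuousLinearMap.comp_apply, ContinuousLinearMap.coe_coe]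
      rw [h1]; abel
    rw [h2, ContinuousLinearMap.comp_apply, hig, h1]
  · refine ContinuousLinearMap.opNorm_le_bound _ (by positivity) fun f => ?_
    calc _ ≤ ‖R‖ * ‖(↑g⁻¹ : E →L[ℂ] E) f‖ := R.le_opNorm _
      _ ≤ ‖R‖ * (2 * ‖f‖) := by gcongr; exact hbd f
      _ = _ := by ring

end Abstract

/-! ### The coordinates `a = u₁'/ρ` and `b = u₂'` on `H̃` -/

/-- The primitive of `b` that vanishes at the origin. -/
noncomputable def primitive (b : ℝ → ℂ) (ρ : ℝ) : ℂ := ∫ r in (0 : ℝ)..ρ, b r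

theorem hasD_primitive {u : ℝ → ℂ} (hu : ContinuousOn u I) {ρ : ℝ} (hρ : ρ ∈ I) :
    HasDerivWithinAt (primitive u) (u ρ) I ρ := by
  have : Fact (ρ ∈ Icc (0 : ℝ) 1) := ⟨hρ⟩
  exact intervalIntegral.integral_hasDerivWithinAt_right
    ((hu.mono (Icc_subset_Icc_right hρ.2)).intervalIntegrable_of_Icc hρ.1)
    (hu.stronglyMeasurableAtFilter_nhdsWithin measurableSet_Icc ρ) (hu ρ hρ)

theorem contDiffOn_primitive {u : ℝ → ℂ} {n : ℕ} (hu : ContDiffOn ℝ n u I) :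
    ContDiffOn ℝ (n + 1 : ℕ) (primitive u) I := by
  have h := fun ρ (hρ : ρ ∈ I) => hasD_primitive hu.continuousOn hρ
  rw [show ((n + 1 : ℕ) : WithTop ℕ∞) = (n : WithTop ℕ∞) + 1 by norm_num,
    contDiffOn_succ_iff_derivWithin uniqueDiff]
  exact ⟨fun ρ hρ => (h ρ hρ).differentiableWithinAt, by simp,
    hu.congr fun ρ hρ => D_eq hρ (h ρ hρ)⟩

theorem contDiffOn_K_succ {u : ℝ → ℂ} {n : ℕ} (hu : ContDiffOn ℝ n u I) :
    ContDiffOn ℝ (n + 1 : ℕ) (K u) I :=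
  contDiffOn_primitive (contDiffOn_id'.mul hu)

theorem D_primitive {u : ℝ → ℂ} (hu : ContinuousOn u I) {ρ : ℝ} (hρ : ρ ∈ I) :
    D (I.indicator (primitive u)) ρ = u ρ := by
  rw [D_indicator hρ, D_eq hρ (hasD_primitive hu hρ)]

theorem D_K {u : ℝ → ℂ} (hu : ContinuousOn u I) {ρ : ℝ} (hρ : ρ ∈ I) :
    D (I.indicator (K u)) ρ = ρ * u ρ := by
  rw [D_indicator hρ, D_eq hρ (hasD_K hu hρ)]

theorem primitive_mem {u : ℝ → ℂ} (hu : ContinuousOn u I) :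
    I.indicator (primitive u) ∈ preH2 :=
  ⟨mem_Ck_indicator (contDiffOn_primitive (n := 0) (contDiffOn_zero.2 hu)),
    by simp [primitive]⟩

theorem K_mem {u : ℝ → ℂ} (hu : ContDiffOn ℝ (1 : ℕ) u I) : I.indicator (K u) ∈ preH1 :=
  ⟨mem_Ck_indicator (contDiffOn_K hu), by simp [K],
    by rw [D_K hu.continuousOn zero_mem_I]; simp⟩

/-- The element `u` of `H̃` with `u₁' = ρ a` and `u₂' = b`. -/
noncomputable def ofDeriv (a b : ℝ → ℂ) (ha : ContDiffOn ℝ (1 : ℕ) a I)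
    (hb : ContDiffOn ℝ (1 : ℕ) b I) : Ht :=
  WithLp.toLp 2 (H1t.mk _ (K_mem ha), H2t.mk _ (primitive_mem hb.continuousOn))

theorem D_ofDeriv_fst {a b : ℝ → ℂ} (ha : ContDiffOn ℝ (1 : ℕ) a I)
    (hb : ContDiffOn ℝ (1 : ℕ) b I) {ρ : ℝ} (hρ : ρ ∈ I) :
    D (ofDeriv a b ha hb).fst.fn ρ = ρ * a ρ :=
  D_K ha.continuousOn hρ

theorem D_ofDeriv_snd {a b : ℝ → ℂ} (ha : ContDiffOn ℝ (1 : ℕ) a I)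
    (hb : ContDiffOn ℝ (1 : ℕ) b I) {ρ : ℝ} (hρ : ρ ∈ I) :
    D (ofDeriv a b ha hb).snd.fn ρ = b ρ :=
  D_primitive hb.continuousOn hρ

/-- From `u₁' = ρa` one gets `u₁''(0) = a(0)`: the third boundary condition of the domain is exactly
`a(0) = 0`, and the other ones are automatic. -/
theorem ofDeriv_mem_domL0t {a b : ℝ → ℂ} (ha : ContDiffOn ℝ (2 : ℕ) a I)
    (hb : ContDiffOn ℝ (2 : ℕ) b I) (h0 : a 0 = 0) :
    ofDeriv a b (ha.of_le (by norm_num)) (hb.of_le (by norm_num)) ∈ domL0t := by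
  have ha' : ContDiffOn ℝ (1 : ℕ) a I := ha.of_le (by norm_num)
  refine ⟨⟨mem_Ck_indicator (contDiffOn_K_succ ha), by simp [ofDeriv, K], ?_, ?_⟩,
    mem_Ck_indicator (contDiffOn_primitive hb), by simp [ofDeriv, primitive]⟩
  · rw [D_ofDeriv_fst _ _ zero_mem_I]; simp
  · rw [D_congr (fun ρ hρ => D_ofDeriv_fst ha' _ hρ) zero_mem_I]
    exact D_eq zero_mem_I ((hasD_id.mul (hasD ha' le_rfl zero_mem_I)).congr_deriv (by simp [h0]))

theorem eq_of_D_eq {u v : ℝ → ℂ} {n : ℕ} (hn : 1 ≤ n) (hu : u ∈ Ck n) (hv : v ∈ Ck n)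
    (hu0 : u 0 = 0) (hv0 : v 0 = 0) (h : ∀ ρ ∈ I, D u ρ = D v ρ) : u = v := by
  refine sub_eq_zero.1 (eq_zero_of_D_ae hn (sub_mem hu hv) (by simp [hu0, hv0]) ?_)
  filter_upwards [ae_restrict_mem measurableSet_Ioc] with ρ hρ
  have hρ' := Ioc_subset_Icc_self hρ
  exact (D_eq hρ' ((hasD hu.1 hn hρ').sub (hasD hv.1 hn hρ'))).trans (sub_eq_zero.2 (h ρ hρ'))

/-- All components vanish at `0`, so identities in `H̃` can be verified on derivatives, that is, in
the coordinates `a` and `b`. -/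
theorem Ht_ext_D {u v : Ht} (h1 : ∀ ρ ∈ I, D u.fst.fn ρ = D v.fst.fn ρ)
    (h2 : ∀ ρ ∈ I, D u.snd.fn ρ = D v.snd.fn ρ) : u = v :=
  Ht_ext (eq_of_D_eq (by norm_num) u.fst.mem.1 v.fst.mem.1 u.fst.mem.2.1 v.fst.mem.2.1 h1)
    (eq_of_D_eq le_rfl u.snd.mem.1 v.snd.mem.1 u.snd.mem.2 v.snd.mem.2 h2)

theorem D_sub_fst (u v : Ht) {ρ : ℝ} (hρ : ρ ∈ I) :
    D (u - v).fst.fn ρ = D u.fst.fn ρ - D v.fst.fn ρ := by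
  simp only [WithLp.sub_fst, map_sub]
  exact D_eq hρ ((hasD u.fst.mem.1.1 (by norm_num) hρ).sub
    (hasD v.fst.mem.1.1 (by norm_num) hρ))

theorem D_sub_snd (u v : Ht) {ρ : ℝ} (hρ : ρ ∈ I) :
    D (u - v).snd.fn ρ = D u.snd.fn ρ - D v.snd.fn ρ := by
  simp only [WithLp.sub_snd, map_sub]
  exact D_eq hρ ((hasD u.snd.mem.1.1 le_rfl hρ).sub (hasD v.snd.mem.1.1 le_rfl hρ))

theorem D_smul_fst (c : ℂ) (u : Ht) {ρ : ℝ} (hρ : ρ ∈ I) :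
    D (c • u).fst.fn ρ = c * D u.fst.fn ρ := by
  simp only [WithLp.smul_fst, map_smul]
  exact D_smul (by norm_num) c u.fst.mem.1.1 hρ

theorem D_smul_snd (c : ℂ) (u : Ht) {ρ : ℝ} (hρ : ρ ∈ I) :
    D (c • u).snd.fn ρ = c * D u.snd.fn ρ := by
  simp only [WithLp.smul_snd, map_smul]
  exact D_smul le_rfl c u.snd.mem.1.1 hρ

theorem norm_sq_Ht (u : Ht) : ‖u‖ ^ 2 =
    (∫ ρ in (0 : ℝ)..1, ‖D u.fst.fn ρ‖ ^ 2 / ρ ^ 2) + ∫ ρ in (0 : ℝ)..1, ‖D u.snd.fn ρ‖ ^ 2 := by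
  rw [WithLp.prod_norm_sq_eq_of_L2, norm_sq1, norm_sq2]

theorem norm_fst_le (u : Ht) : ‖u.fst‖ ≤ ‖u‖ := by
  have := WithLp.prod_norm_sq_eq_of_L2 u
  exact (abs_le_of_sq_le_sq' (by nlinarith [sq_nonneg ‖u.snd‖]) (norm_nonneg _)).2

theorem norm_snd_le (u : Ht) : ‖u.snd‖ ≤ ‖u‖ := by
  have := WithLp.prod_norm_sq_eq_of_L2 u
  exact (abs_le_of_sq_le_sq' (by nlinarith [sq_nonneg ‖u.fst‖]) (norm_nonneg _)).2

/-- The `L²` norm of `(a, b)` on an interval of length one is controlled by the sup norms; the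
constant `2` replaces `√2`. -/
theorem norm_le_of_D_le {u : Ht} {c : ℝ} (hc : 0 ≤ c) (h1 : ∀ ρ ∈ I, ‖D u.fst.fn ρ‖ ≤ c * ρ)
    (h2 : ∀ ρ ∈ I, ‖D u.snd.fn ρ‖ ≤ c) : ‖u‖ ≤ 2 * c := by
  have e1 : ∫ ρ in (0 : ℝ)..1, ‖D u.fst.fn ρ‖ ^ 2 / ρ ^ 2 ≤ ∫ _ in (0 : ℝ)..1, c ^ 2 := by
    refine intervalIntegral.integral_mono_on zero_le_one (integrable1_self _) (by simp) ?_
    intro x hx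
    rcases hx.1.eq_or_lt with h | h
    -- At `ρ = 0` the quotient is `0` by the convention for division by zero.
    · rw [← h]; simp; positivity
    rw [div_le_iff₀ (by positivity), ← mul_pow]
    exact pow_le_pow_left₀ (norm_nonneg _) (h1 x hx) 2
  have e2 : ∫ ρ in (0 : ℝ)..1, ‖D u.snd.fn ρ‖ ^ 2 ≤ ∫ _ in (0 : ℝ)..1, c ^ 2 :=
    intervalIntegral.integral_mono_on zero_le_one (integrable2_self _) (by simp) fun x hx =>
      pow_le_pow_left₀ (norm_nonneg _) (h2 x hx) 2
  simp only [intervalIntegral.integral_const, sub_zero, one_smul] at e1 e2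
  have e3 := norm_sq_Ht u
  exact (abs_le_of_sq_le_sq' (by nlinarith [sq_nonneg c]) (by positivity)).2

/-! ### The free operator in these coordinates and its dissipativity -/

/-- The quotient `u₁' / ρ` for the first component of an element of the domain of `L̃₀`. -/
theorem contDiffOn_D_div (u : domL0t) :
    ContDiffOn ℝ (1 : ℕ) (fun ρ : ℝ => D u.1.fst.fn ρ / ρ) I :=
  contDiffOn_div (contDiffOn_D u.2.1.1.1 (m := 2) (by norm_num)) u.2.1.2.2.1 u.2.1.2.2.2

theorem D_fst_eq_mul (u : domL0t) {ρ : ℝ} (_ : ρ ∈ I) :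
    D u.1.fst.fn ρ = ρ * (D u.1.fst.fn ρ / ρ) := by
  rcases eq_or_ne ρ 0 with rfl | h
  · simp [u.2.1.2.2.1]
  · have : (ρ : ℂ) ≠ 0 := by exact_mod_cast h
    field_simp

/-- Differentiating cancels the undifferentiated terms `u₁` and `u₂` of `L̃₀`, leaving `ρ(u₂'' -
u₁'')`; then `u₁'' = a + ρa'`. -/
theorem D_L0fun_fst (u : domL0t) {ρ : ℝ} (hρ : ρ ∈ I) : D (L0fun u).fst.fn ρ =
    ρ * (-(D u.1.fst.fn ρ / ρ) - ρ * D (fun ρ : ℝ => D u.1.fst.fn ρ / ρ) ρ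
      + D (D u.1.snd.fn) ρ) := by
  obtain ⟨⟨h1, -, -, -⟩, h2, -⟩ := u.2
  have a1 := hasD (contDiffOn_D h1.1 (m := 2) (by norm_num)) (by norm_num) hρ
  have a2 := hasD (contDiffOn_D h2.1 (m := 2) (by norm_num)) (by norm_num) hρ
  have b1 := hasD h1.1 (by norm_num) hρ
  have b2 := hasD h2.1 (by norm_num) hρ
  have e : D (D u.1.fst.fn) ρ = D u.1.fst.fn ρ / ρ +
      ρ * D (fun ρ : ℝ => D u.1.fst.fn ρ / ρ) ρ := by
    rw [D_congr (fun x hx => D_fst_eq_mul u hx) hρ]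
    exact D_eq hρ ((hasD_id.mul (hasD (contDiffOn_D_div u) le_rfl hρ)).congr_deriv (by simp))
  have h : D (l01 u.1.fst.fn u.1.snd.fn) ρ =
      -ρ * D (D u.1.fst.fn) ρ + ρ * D (D u.1.snd.fn) ρ := by
    rw [l01, D_indicator hρ]
    refine D_eq hρ (((((hasD_id (ρ := ρ)).neg.mul a1).add b1).add (hasD_id.mul a2)).sub b2
      |>.congr_deriv ?_)
    simp only [Pi.neg_apply]
    ring
  refine (show _ = D (l01 u.1.fst.fn u.1.snd.fn) ρ from rfl).trans ?_
  rw [h, e]; ring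

theorem D_L0fun_snd (u : domL0t) {ρ : ℝ} (hρ : ρ ∈ I) : D (L0fun u).snd.fn ρ =
    D (fun ρ : ℝ => D u.1.fst.fn ρ / ρ) ρ - D u.1.snd.fn ρ - ρ * D (D u.1.snd.fn) ρ := by
  have a2 := hasD (contDiffOn_D u.2.2.1.1 (m := 2) (by norm_num)) (by norm_num) hρ
  refine (show _ = D (l02 u.1.fst.fn u.1.snd.fn) ρ from rfl).trans ?_
  rw [l02, D_indicator hρ]
  refine D_eq hρ (((hasD (contDiffOn_D_div u) le_rfl hρ).sub (hasD_id.mul a2)).congr_deriv ?_)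
  ring

theorem inner_Ht (u v : Ht) : ⟪u, v⟫_ℂ =
    (∫ ρ in (0 : ℝ)..1, conj (D u.fst.fn ρ) * D v.fst.fn ρ / (ρ : ℂ) ^ 2) +
      ∫ ρ in (0 : ℝ)..1, conj (D u.snd.fn ρ) * D v.snd.fn ρ :=
  WithLp.prod_inner_apply u v

/-- Energy identity: `2 Re (ā a') = (|a|²)'`, and the coupling terms combine to `Re (ā b)'`.
Integrating `-½ρ(|a|² + |b|²)'` by parts returns half of the damping `-(|a|² + |b|²)`, which is
where the rate `½` comes from. -/
theorem re_inner_L0fun_le (u : domL0t) :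
    (⟪u.1, L0fun u⟫_ℂ).re ≤ -(1 / 2) * ‖u.1‖ ^ 2 := by
  set a : ℝ → ℂ := fun ρ => D u.1.fst.fn ρ / ρ with ha
  set b : ℝ → ℂ := D u.1.snd.fn with hb
  have hac : ContDiffOn ℝ (1 : ℕ) a I := contDiffOn_D_div u
  have hbc : ContDiffOn ℝ (1 : ℕ) b I := contDiffOn_D u.2.2.1.1 (by norm_num)
  have i1 := integrable1 u.1.fst (L0fun u).fst
  have i2 := integrable2 u.1.snd (L0fun u).snd
  have j1 := integrable1_self u.1.fst
  have j2 := integrable2_self u.1.snd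
  set g : ℝ → ℝ := fun ρ => (conj (D u.1.fst.fn ρ) * D (L0fun u).fst.fn ρ / (ρ : ℂ) ^ 2 +
      conj (D u.1.snd.fn ρ) * D (L0fun u).snd.fn ρ).re +
      1 / 2 * (‖D u.1.fst.fn ρ‖ ^ 2 / ρ ^ 2 + ‖D u.1.snd.fn ρ‖ ^ 2) with hg
  have hre : IntervalIntegrable (fun ρ : ℝ => (conj (D u.1.fst.fn ρ) * D (L0fun u).fst.fn ρ /
      (ρ : ℂ) ^ 2 + conj (D u.1.snd.fn ρ) * D (L0fun u).snd.fn ρ).re) volume 0 1 :=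
    ⟨(i1.add i2).1.re, (i1.add i2).2.re⟩
  have hgi : IntervalIntegrable g volume 0 1 := hre.add ((j1.add j2).const_mul _)
  -- The energy flux: `Φ' = g` in the interior, so only boundary values remain.
  set Φ : ℝ → ℝ := fun ρ => -ρ * (‖a ρ‖ ^ 2 + ‖b ρ‖ ^ 2) / 2 + (conj (a ρ) * b ρ).re with hΦ
  have hint : ∫ ρ in (0 : ℝ)..1, g ρ = Φ 1 - Φ 0 := by
    refine intervalIntegral.integral_eq_sub_of_hasDerivAt_of_le zero_le_one ?_ ?_ hgi
    · have h1 := hac.continuousOn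
      have h2 := hbc.continuousOn
      have h3 : ContinuousOn (fun ρ => (conj (a ρ) * b ρ).re) I :=
        Complex.continuous_re.comp_continuousOn
          ((Complex.continuous_conj.comp_continuousOn h1).mul h2)
      exact ((continuousOn_id.neg.mul ((h1.norm.pow 2).add (h2.norm.pow 2))).div_const 2).add h3
    · intro ρ hρ
      have hρ' := Ioo_subset_Icc_self hρ
      have hn : I ∈ 𝓝 ρ := Icc_mem_nhds hρ.1 hρ.2
      have d1 := (hasD hac le_rfl hρ').hasDerivAt hn
      have d2 := (hasD hbc le_rfl hρ').hasDerivAt hn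
      have hre : ∀ {f : ℝ → ℂ} {f' : ℂ}, HasDerivAt f f' ρ →
          HasDerivAt (fun x => (f x).re) f'.re ρ := fun h =>
        Complex.reCLM.hasFDerivAt.comp_hasDerivAt ρ h
      have him : ∀ {f : ℝ → ℂ} {f' : ℂ}, HasDerivAt f f' ρ →
          HasDerivAt (fun x => (f x).im) f'.im ρ := fun h =>
        Complex.imCLM.hasFDerivAt.comp_hasDerivAt ρ h
      have hΦ' : Φ = fun ρ => -ρ * ((a ρ).re * (a ρ).re + (a ρ).im * (a ρ).im +
          ((b ρ).re * (b ρ).re + (b ρ).im * (b ρ).im)) / 2 +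
          ((a ρ).re * (b ρ).re + (a ρ).im * (b ρ).im) := by
        funext x
        simp only [hΦ, Complex.sq_norm, Complex.normSq_apply, Complex.mul_re, Complex.conj_re,
          Complex.conj_im]
        ring
      have hρ0 : (ρ : ℂ) ≠ 0 := by exact_mod_cast hρ.1.ne'
      have hgρ : g ρ = (conj (a ρ) * (-a ρ - ρ * D a ρ + D b ρ) +
          conj (b ρ) * (D a ρ - b ρ - ρ * D b ρ)).re + 1 / 2 * (‖a ρ‖ ^ 2 + ‖b ρ‖ ^ 2) := by
        simp only [hg]
        rw [D_L0fun_fst u hρ', D_L0fun_snd u hρ']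
        congr 2
        · congr 1
          simp only [ha, map_div₀, Complex.conj_ofReal]
          field_simp
          rfl
        · simp only [ha, norm_div, Complex.norm_real, Real.norm_eq_abs, div_pow, sq_abs]
          rfl
      rw [hΦ', hgρ]
      refine ((((hasDerivAt_id ρ).neg.mul ((((hre d1).mul (hre d1)).add
        ((him d1).mul (him d1))).add (((hre d2).mul (hre d2)).add
        ((him d2).mul (him d2))))).div_const 2).add
        (((hre d1).mul (hre d2)).add ((him d1).mul (him d2)))).congr_deriv ?_
      simp [Complex.sq_norm, Complex.normSq_apply]
      ring
  have hΦ0 : Φ 0 = 0 := by simp [hΦ, ha]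
  -- `Φ(1) = -½|a(1) - b(1)|²`: on the light cone energy can only leave.
  have hΦ1 : Φ 1 ≤ 0 := by
    simp only [hΦ, Complex.sq_norm, Complex.normSq_apply, Complex.mul_re, Complex.conj_re,
      Complex.conj_im]
    nlinarith [sq_nonneg ((a 1).re - (b 1).re), sq_nonneg ((a 1).im - (b 1).im)]
  have hsum : ∫ ρ in (0 : ℝ)..1, g ρ = (⟪u.1, L0fun u⟫_ℂ).re + 1 / 2 * ‖u.1‖ ^ 2 := by
    rw [hg, intervalIntegral.integral_add hre ((j1.add j2).const_mul _),
      intervalIntegral.integral_const_mul, intervalIntegral.integral_add j1 j2, ← norm_sq_Ht,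
      inner_Ht, ← intervalIntegral.integral_add i1 i2]
    congr 1
    exact Complex.reCLM.intervalIntegral_comp_comm (i1.add i2)
  linarith

/-! ### Polynomial data: density of the domain and of the range of `z - L̃₀` -/

open Polynomial in
/-- The first-order equation `μ P + (X + c) P' = F` is solvable in polynomials. -/
theorem exists_polynomial_transport {μ : ℂ} (hμ : ∀ n : ℕ, μ + n ≠ 0) (c : ℂ) (F : ℂ[X]) :
    ∃ P : ℂ[X], C μ * P + (X + C c) * derivative P = F := by
  have hX : ∀ n : ℕ, ∃ P : ℂ[X], C μ * P + (X + C c) * derivative P = X ^ n := by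
    intro n
    induction n with
    | zero =>
      have h : μ ≠ 0 := by simpa using hμ 0
      exact ⟨C μ⁻¹, by rw [derivative_C, mul_zero, add_zero, ← C_mul, mul_inv_cancel₀ h]; simp⟩
    | succ n ih =>
      obtain ⟨P, hP⟩ := ih
      have h : μ + (n + 1 : ℕ) ≠ 0 := hμ (n + 1)
      -- The operator sends `X ^ (n + 1)` to `(μ + n + 1) X ^ (n + 1) + (n + 1) c X ^ n`; the
      -- solution `P` for `X ^ n` removes the lower term.
      refine ⟨C (μ + (n + 1 : ℕ))⁻¹ * (X ^ (n + 1) - C ((n + 1 : ℕ) * c) * P), ?_⟩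
      have e : C (μ + (n + 1 : ℕ))⁻¹ * (C μ + C ((n + 1 : ℕ) : ℂ)) = (1 : ℂ[X]) := by
        rw [← C_add, ← C_mul, inv_mul_cancel₀ h, C_1]
      simp only [derivative_mul, derivative_C, zero_mul, zero_add, derivative_sub,
        derivative_X_pow, add_tsub_cancel_right, C_mul]
      linear_combination X ^ (n + 1) * e -
        C (μ + (n + 1 : ℕ))⁻¹ * C ((n + 1 : ℕ) : ℂ) * C c * hP
  induction F using Polynomial.induction_on' with
  | add p q hp hq =>
    obtain ⟨P, hP⟩ := hp
    obtain ⟨Q, hQ⟩ := hq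
    exact ⟨P + Q, by rw [derivative_add, ← hP, ← hQ]; ring⟩
  | monomial n a =>
    obtain ⟨P, hP⟩ := hX n
    refine ⟨C a * P, ?_⟩
    rw [← C_mul_X_pow_eq_monomial, ← hP, derivative_mul, derivative_C]
    ring

open Polynomial in
theorem exists_polynomial_near {f : ℝ → ℂ} (hf : ContinuousOn f I) {ε : ℝ} (hε : 0 < ε) :
    ∃ P : ℂ[X], ∀ ρ ∈ I, ‖P.eval (ρ : ℂ) - f ρ‖ ≤ ε := by
  obtain ⟨p, hp⟩ := exists_polynomial_near_of_continuousOn 0 1 (fun ρ => (f ρ).re)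
    (Complex.continuous_re.comp_continuousOn hf) (ε / 2) (by positivity)
  obtain ⟨q, hq⟩ := exists_polynomial_near_of_continuousOn 0 1 (fun ρ => (f ρ).im)
    (Complex.continuous_im.comp_continuousOn hf) (ε / 2) (by positivity)
  have he : ∀ (r : ℝ[X]) (ρ : ℝ), (r.map Complex.ofRealHom).eval (ρ : ℂ) = (r.eval ρ : ℝ) :=
    fun r ρ => by rw [eval_map]; exact eval₂_at_apply Complex.ofRealHom ρ
  refine ⟨p.map Complex.ofRealHom + C Complex.I * q.map Complex.ofRealHom, fun ρ hρ => ?_⟩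
  refine (Complex.norm_le_abs_re_add_abs_im _).trans ?_
  have h1 := (hp ρ hρ).le
  have h2 := (hq ρ hρ).le
  simp only [eval_add, eval_mul, eval_C, he]
  simp only [Complex.sub_re, Complex.add_re, Complex.ofReal_re, Complex.mul_re, Complex.I_re,
    Complex.I_im, Complex.ofReal_im, Complex.sub_im, Complex.add_im, Complex.mul_im]
  simp only [zero_mul, one_mul, mul_zero, sub_zero, add_zero, zero_add]
  linarith

theorem contDiffOn_eval (P : Polynomial ℂ) {n : ℕ} :
    ContDiffOn ℝ n (fun ρ : ℝ => P.eval (ρ : ℂ)) I :=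
  ((P.contDiff_aeval (𝕜 := ℂ) n).restrict_scalars ℝ |>.comp
    Complex.ofRealCLM.contDiff).contDiffOn

theorem hasD_eval (P : Polynomial ℂ) (ρ : ℝ) :
    HasDerivWithinAt (fun ρ : ℝ => P.eval (ρ : ℂ)) (P.derivative.eval (ρ : ℂ)) I ρ :=
  (P.hasDerivAt (ρ : ℂ)).comp_ofReal.hasDerivWithinAt

/-- The element `u` of `H̃` with `u₁' = ρ F(ρ)` and `u₂' = G(ρ)` for polynomials `F`, `G`. -/
noncomputable def ofPoly (F G : Polynomial ℂ) : Ht :=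
  ofDeriv (fun ρ : ℝ => F.eval (ρ : ℂ)) (fun ρ : ℝ => G.eval (ρ : ℂ)) (contDiffOn_eval F)
    (contDiffOn_eval G)

theorem D_ofPoly_fst (F G : Polynomial ℂ) {ρ : ℝ} (hρ : ρ ∈ I) :
    D (ofPoly F G).fst.fn ρ = ρ * F.eval (ρ : ℂ) :=
  D_ofDeriv_fst _ _ hρ

theorem D_ofPoly_snd (F G : Polynomial ℂ) {ρ : ℝ} (hρ : ρ ∈ I) :
    D (ofPoly F G).snd.fn ρ = G.eval (ρ : ℂ) :=
  D_ofDeriv_snd _ _ hρ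

/-- If `g ∈ C¹[0,1]` and `g(0) = 0`, then `g(ρ) = ρ f(ρ)` with a continuous `f`. -/
theorem exists_continuousOn_eq_mul {g : ℝ → ℂ} (hg : ContDiffOn ℝ (1 : ℕ) g I) (h0 : g 0 = 0) :
    ∃ f : ℝ → ℂ, ContinuousOn f I ∧ ∀ ρ ∈ I, g ρ = ρ * f ρ := by
  classical
  -- The quotient has default value `0` at the origin; continuity requires `g'(0)` there.
  refine ⟨Function.update (fun ρ : ℝ => g ρ / ρ) 0 (D g 0), ?_, fun ρ _ => ?_⟩
  · rw [continuousOn_update_iff]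
    refine ⟨ContinuousOn.div (hg.continuousOn.mono sdiff_subset)
      Complex.continuous_ofReal.continuousOn fun x hx => ?_, fun _ => ?_⟩
    · have : x ≠ 0 := fun h => hx.2 h
      exact_mod_cast this
    · have h := hasDerivWithinAt_iff_tendsto_slope.1 (hasD hg le_rfl zero_mem_I)
      refine h.congr fun x => ?_
      simp [slope, h0, div_eq_inv_mul]
  · rcases eq_or_ne ρ 0 with rfl | h
    · simp [h0]
    · have : (ρ : ℂ) ≠ 0 := by exact_mod_cast h
      rw [Function.update_of_ne h]
      field_simp

/-- Weierstrass approximation of `a` and `b` in sup norm. Nothing forces `F(0) = 0`, so the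
approximant need not lie in the domain of `L̃₀`. -/
theorem exists_ofPoly_near (u : Ht) {ε : ℝ} (hε : 0 < ε) :
    ∃ F G : Polynomial ℂ, ‖ofPoly F G - u‖ ≤ ε := by
  obtain ⟨f, hf, hfu⟩ := exists_continuousOn_eq_mul
    (contDiffOn_D u.fst.mem.1.1 (m := 1) (by norm_num)) u.fst.mem.2.2
  obtain ⟨F, hF⟩ := exists_polynomial_near hf (half_pos hε)
  obtain ⟨G, hG⟩ := exists_polynomial_near (contOn_D2 u.snd) (half_pos hε)
  refine ⟨F, G, ?_⟩
  calc _ ≤ 2 * (ε / 2) := norm_le_of_D_le (half_pos hε).le (fun ρ hρ => ?_) fun ρ hρ => ?_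
    _ = ε := by ring
  · rw [D_sub_fst _ _ hρ, D_ofPoly_fst _ _ hρ, hfu ρ hρ, ← mul_sub, norm_mul, Complex.norm_real,
      Real.norm_eq_abs, abs_of_nonneg hρ.1, mul_comm]
    exact mul_le_mul_of_nonneg_right (hF ρ hρ) hρ.1
  · rw [D_sub_snd _ _ hρ, D_ofPoly_snd _ _ hρ]
    exact hG ρ hρ

open Polynomial in
-- These elements have `a(0) = c` but arbitrarily small norm as `n` grows: the `L²` norm does not
-- see the condition `a(0) = 0`.
theorem norm_sq_ofPoly_pow (c : ℂ) (n : ℕ) :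
    ‖ofPoly (C c * (1 - X) ^ n) 0‖ ^ 2 = ‖c‖ ^ 2 / (2 * n + 1) := by
  have h1 : ∫ ρ in (0 : ℝ)..1, ‖D (ofPoly (C c * (1 - X) ^ n) 0).fst.fn ρ‖ ^ 2 / ρ ^ 2 =
      ∫ ρ in (0 : ℝ)..1, ‖c‖ ^ 2 * (1 - ρ) ^ (2 * n) := by
    -- The origin must be left out: the quotient there is `0` by default, the right-hand side
    -- `‖c‖²`.
    refine intervalIntegral.integral_congr_ae (ae_of_all _ fun ρ hρ => ?_)
    rw [uIoc_of_le zero_le_one] at hρ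
    have hρ0 := hρ.1
    rw [D_ofPoly_fst _ _ (Ioc_subset_Icc_self hρ)]
    have e : (1 : ℂ) - ρ = ((1 - ρ : ℝ) : ℂ) := by push_cast; rfl
    simp only [eval_mul, eval_C, eval_pow, eval_sub, eval_one, eval_X, e, norm_mul, norm_pow,
      Complex.norm_real, Real.norm_eq_abs, mul_pow, sq_abs]
    rw [← pow_mul, mul_comm n 2, pow_mul |1 - ρ|, sq_abs, ← pow_mul]
    field_simp
  have h2 : ∫ ρ in (0 : ℝ)..1, ‖D (ofPoly (C c * (1 - X) ^ n) 0).snd.fn ρ‖ ^ 2 = 0 := by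
    refine (intervalIntegral.integral_congr (g := fun _ => (0 : ℝ)) fun ρ hρ => ?_).trans
      intervalIntegral.integral_zero
    rw [uIcc_of_le zero_le_one] at hρ
    simp [D_ofPoly_snd _ _ hρ]
  rw [norm_sq_Ht, h1, h2, add_zero, intervalIntegral.integral_const_mul,
    intervalIntegral.integral_comp_sub_left (fun x : ℝ => x ^ (2 * n)) 1, integral_pow]
  simp [div_eq_mul_inv]

open Polynomial in
-- A polynomial approximant is moved into the domain by subtracting `c(1 - ρ)ⁿ` from `a`, with `c`
-- its value at `0` and `n` large.
theorem dense_domL0t : Dense (domL0t : Set Ht) := by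
  refine Metric.dense_iff.2 fun u ε hε => ?_
  obtain ⟨F, G, hFG⟩ := exists_ofPoly_near u (show 0 < ε / 3 by positivity)
  set c := F.eval 0
  obtain ⟨n, hn⟩ := exists_nat_gt (‖c‖ ^ 2 / (ε / 3) ^ 2)
  have hmem : ofPoly (F - C c * (1 - X) ^ n) G ∈ domL0t :=
    ofDeriv_mem_domL0t (contDiffOn_eval _) (contDiffOn_eval _) (by simp [c])
  have hsub : ofPoly F G - ofPoly (F - C c * (1 - X) ^ n) G = ofPoly (C c * (1 - X) ^ n) 0 := by
    refine Ht_ext_D (fun ρ hρ => ?_) fun ρ hρ => ?_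
    · rw [D_sub_fst _ _ hρ, D_ofPoly_fst _ _ hρ, D_ofPoly_fst _ _ hρ, D_ofPoly_fst _ _ hρ,
        eval_sub]
      ring
    · rw [D_sub_snd _ _ hρ, D_ofPoly_snd _ _ hρ, D_ofPoly_snd _ _ hρ, D_ofPoly_snd _ _ hρ]
      simp
  have hle : ‖ofPoly (C c * (1 - X) ^ n) 0‖ ≤ ε / 3 := by
    refine (abs_le_of_sq_le_sq' ?_ (by positivity)).2
    rw [norm_sq_ofPoly_pow, div_le_iff₀ (by positivity)]
    rw [div_lt_iff₀ (by positivity)] at hn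
    nlinarith [sq_nonneg (ε / 3), n.cast_nonneg (α := ℝ)]
  refine ⟨_, ?_, hmem⟩
  rw [Metric.mem_ball, dist_eq_norm]
  have e : ofPoly (F - C c * (1 - X) ^ n) G - u =
      (ofPoly F G - u) - ofPoly (C c * (1 - X) ^ n) 0 := by rw [← hsub]; abel
  rw [e]
  have := norm_sub_le (ofPoly F G - u) (ofPoly (C c * (1 - X) ^ n) 0)
  linarith

theorem D_L0fun_ofDeriv {a b : ℝ → ℂ} (ha : ContDiffOn ℝ (2 : ℕ) a I)
    (hb : ContDiffOn ℝ (2 : ℕ) b I) (h0 : a 0 = 0) {ρ : ℝ} (hρ : ρ ∈ I) :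
    D (L0fun ⟨_, ofDeriv_mem_domL0t ha hb h0⟩).fst.fn ρ =
        ρ * (-a ρ - ρ * D a ρ + D b ρ) ∧
      D (L0fun ⟨_, ofDeriv_mem_domL0t ha hb h0⟩).snd.fn ρ = D a ρ - b ρ - ρ * D b ρ := by
  have ha1 : ContDiffOn ℝ (1 : ℕ) a I := ha.of_le (by norm_num)
  have hb1 : ContDiffOn ℝ (1 : ℕ) b I := hb.of_le (by norm_num)
  have e1 : ∀ x ∈ I, D (ofDeriv a b ha1 hb1).fst.fn x / x = a x := fun x hx => by
    rw [D_ofDeriv_fst ha1 hb1 hx]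
    rcases eq_or_ne x 0 with rfl | h
    · simp [h0]
    · have : (x : ℂ) ≠ 0 := by exact_mod_cast h
      field_simp
  have e2 : ∀ x ∈ I, D (ofDeriv a b ha1 hb1).snd.fn x = b x := fun x hx =>
    D_ofDeriv_snd ha1 hb1 hx
  rw [D_L0fun_fst _ hρ, D_L0fun_snd _ hρ]
  simp only [e1 ρ hρ, e2 ρ hρ, D_congr e1 hρ, D_congr e2 hρ, and_self]

/-- The function is `(1 + ρ)^(-μ)`, the solution of `μq + (1 + ρ)q' = 0` with value `1` at the
origin. -/
theorem hasD_exp_log (μ : ℂ) {ρ : ℝ} (hρ : ρ ∈ I) :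
    HasDerivWithinAt (fun ρ : ℝ => Complex.exp (-μ * (Real.log (1 + ρ) : ℝ)))
      (-μ / (1 + ρ) * Complex.exp (-μ * (Real.log (1 + ρ) : ℝ))) I ρ := by
  have h0 : (1 + ρ) ≠ 0 := by linarith [hρ.1]
  have h1 : HasDerivAt (fun x : ℝ => Real.log (1 + x)) (1 / (1 + ρ)) ρ :=
    ((hasDerivAt_id ρ).const_add 1).log h0
  refine ((h1.ofReal_comp.const_mul (-μ)).cexp.congr_deriv ?_).hasDerivWithinAt
  push_cast
  ring

theorem contDiffOn_exp_log (μ : ℂ) {n : ℕ} :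
    ContDiffOn ℝ n (fun ρ : ℝ => Complex.exp (-μ * (Real.log (1 + ρ) : ℝ))) I := by
  have h1 : ContDiffOn ℝ n (fun x : ℝ => Real.log (1 + x)) I :=
    (contDiffOn_const.add contDiffOn_id).log fun x hx => by
      have := hx.1
      simp only [id]
      positivity
  exact (contDiffOn_const.mul (Complex.ofRealCLM.contDiff.comp_contDiffOn h1)).cexp

/-- For `Re z > -1` the equation `(z - L̃₀) u = f` is solvable for polynomial data `f`: in the
variables `p = u₁'/ρ + u₂'` and `q = u₁'/ρ - u₂'` it decouples into
`(z + 1) p - (1 - ρ) p' = F + G` and `(z + 1) q + (1 + ρ) q' = F - G`. -/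
theorem exists_smul_sub_L0fun_eq_ofPoly {z : ℂ} (hz : -1 < z.re) (F G : Polynomial ℂ) :
    ∃ u : domL0t, z • u.1 - L0fun u = ofPoly F G := by
  have hμ : ∀ n : ℕ, z + 1 + n ≠ 0 := fun n h => by
    have := congrArg Complex.re h
    simp only [Complex.add_re, Complex.one_re, Complex.natCast_re, Complex.zero_re] at this
    linarith [n.cast_nonneg (α := ℝ)]
  obtain ⟨P, hP⟩ := exists_polynomial_transport hμ (-1) (F + G)
  obtain ⟨Q, hQ⟩ := exists_polynomial_transport hμ 1 (F - G)
  -- A multiple of the homogeneous solution is added to `q` to achieve `a(0) = (p(0) + q(0))/2 = 0`.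
  -- It has to be `q`: the homogeneous solution `(1 - ρ)^(-(z + 1))` for `p` is singular at `1`.
  set κ : ℂ := -(P.eval 0 + Q.eval 0) with hκ
  set e : ℝ → ℂ := fun ρ => Complex.exp (-(z + 1) * (Real.log (1 + ρ) : ℝ)) with he
  set a : ℝ → ℂ := fun ρ => (P.eval (ρ : ℂ) + (Q.eval (ρ : ℂ) + κ * e ρ)) / 2 with ha
  set b : ℝ → ℂ := fun ρ => (P.eval (ρ : ℂ) - (Q.eval (ρ : ℂ) + κ * e ρ)) / 2 with hb
  have hP2 := contDiffOn_eval P (n := 2)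
  have hQ2 := (contDiffOn_eval Q (n := 2)).add
    (contDiffOn_const (c := κ).mul (contDiffOn_exp_log (z + 1)))
  have ha2 : ContDiffOn ℝ (2 : ℕ) a I := (hP2.add hQ2).div_const 2
  have hb2 : ContDiffOn ℝ (2 : ℕ) b I := (hP2.sub hQ2).div_const 2
  have h0 : a 0 = 0 := by simp [ha, he, hκ]
  have hD : ∀ ρ ∈ I, D a ρ = (P.derivative.eval (ρ : ℂ) + (Q.derivative.eval (ρ : ℂ) +
        κ * (-(z + 1) / (1 + ρ) * e ρ))) / 2 ∧
      D b ρ = (P.derivative.eval (ρ : ℂ) - (Q.derivative.eval (ρ : ℂ) +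
        κ * (-(z + 1) / (1 + ρ) * e ρ))) / 2 := fun ρ hρ => by
    have h2 := (hasD_eval Q ρ).add ((hasD_exp_log (z + 1) hρ).const_mul κ)
    exact ⟨D_eq hρ (((hasD_eval P ρ).add h2).div_const 2),
      D_eq hρ (((hasD_eval P ρ).sub h2).div_const 2)⟩
  refine ⟨⟨_, ofDeriv_mem_domL0t ha2 hb2 h0⟩, Ht_ext_D (fun ρ hρ => ?_) fun ρ hρ => ?_⟩
  all_goals
    have h1 : (1 + ρ : ℂ) ≠ 0 := by
      have : (1 + ρ) ≠ 0 := by linarith [hρ.1]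
      exact_mod_cast this
    have eP := congrArg (Polynomial.eval (ρ : ℂ)) hP
    have eQ := congrArg (Polynomial.eval (ρ : ℂ)) hQ
    simp only [Polynomial.eval_add, Polynomial.eval_mul, Polynomial.eval_C, Polynomial.eval_X,
      Polynomial.eval_sub] at eP eQ
    have ee : (1 + ρ : ℂ) * (-(z + 1) / (1 + ρ) * e ρ) = -(z + 1) * e ρ := by field_simp
    obtain ⟨d1, d2⟩ := hD ρ hρ
  · rw [D_sub_fst _ _ hρ, D_smul_fst _ _ hρ, (D_L0fun_ofDeriv ha2 hb2 h0 hρ).1,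
      D_ofDeriv_fst _ _ hρ, D_ofPoly_fst _ _ hρ, d1, d2]
    simp only [ha]
    linear_combination (ρ / 2 : ℂ) * eP + (ρ / 2 : ℂ) * eQ + (ρ / 2 : ℂ) * κ * ee
  · rw [D_sub_snd _ _ hρ, D_smul_snd _ _ hρ, (D_L0fun_ofDeriv ha2 hb2 h0 hρ).2,
      D_ofDeriv_snd _ _ hρ, D_ofPoly_snd _ _ hρ, d1, d2]
    simp only [hb]
    linear_combination (1 / 2 : ℂ) * eP - (1 / 2 : ℂ) * eQ - (1 / 2 : ℂ) * κ * ee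

/-- The range of `z - L̃₀` is dense in `H̃` for `Re z > -1`. -/
theorem denseRange_smul_sub_L0fun {z : ℂ} (hz : -1 < z.re) :
    DenseRange fun u : domL0t => z • u.1 - L0fun u := by
  refine Metric.dense_iff.2 fun v ε hε => ?_
  obtain ⟨F, G, hFG⟩ := exists_ofPoly_near v (half_pos hε)
  obtain ⟨u, hu⟩ := exists_smul_sub_L0fun_eq_ofPoly hz F G
  exact ⟨_, by rw [Metric.mem_ball, dist_eq_norm]; linarith, u, hu⟩

/-! ### Smallness of `L'` relative to `z - L̃₀` for large `z` -/

/-- Since `u₁(ρ) = ∫₀^ρ r a(r) dr`, it is bounded by `ρ ∫₀^ρ |a|`, and Cauchy-Schwarz does the rest.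
-/
theorem norm_fst_fn_le (u : domL0t) {ρ : ℝ} (hρ : ρ ∈ I) : ‖u.1.fst.fn ρ‖ ≤ ‖u.1‖ * ρ := by
  set a : ℝ → ℂ := fun ρ => D u.1.fst.fn ρ / ρ with ha
  have hac : ContinuousOn a I := (contDiffOn_D_div u).continuousOn
  have hnc : ContinuousOn (fun ρ => ((‖a ρ‖ : ℝ) : ℂ)) I :=
    Complex.continuous_ofReal.comp_continuousOn hac.norm
  have hu : u.1.fst.fn = I.indicator (K a) := by
    refine eq_of_D_eq (n := 1) le_rfl ⟨u.2.1.1.1.of_le (by norm_num), u.2.1.1.2⟩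
      (mem_Ck_indicator (contDiffOn_K_succ (n := 0) (contDiffOn_zero.2 hac))) u.2.1.2.1
      (by simp [K]) fun x hx => ?_
    rw [D_K hac hx]
    exact D_fst_eq_mul u hx
  -- The primitive of `|a|`, as an element of `H̃₂`, has norm `‖a‖` in `L²`; the sup bound
  -- `norm_le2` for it is the required Cauchy-Schwarz inequality.
  set v : H2t := H2t.mk _ (primitive_mem hnc) with hv
  have hvn : ‖v‖ ≤ ‖u.1‖ := by
    refine (abs_le_of_sq_le_sq' ?_ (norm_nonneg _)).2
    have e : ‖v‖ ^ 2 = ‖u.1.fst‖ ^ 2 := by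
      rw [norm_sq1, norm_sq2]
      refine intervalIntegral.integral_congr fun x hx => ?_
      rw [uIcc_of_le zero_le_one] at hx
      have : D v.fn x = ((‖a x‖ : ℝ) : ℂ) := D_primitive hnc hx
      simp only [this, Complex.norm_real, ha, norm_div, Real.norm_eq_abs, div_pow,
        sq_abs]
    rw [e]
    exact pow_le_pow_left₀ (norm_nonneg _) (norm_fst_le _) 2
  have hsub : Icc 0 ρ ⊆ I := Icc_subset_Icc_right hρ.2
  have h1 : ‖K a ρ‖ ≤ ∫ r in (0 : ℝ)..ρ, ρ * ‖a r‖ := by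
    refine (intervalIntegral.norm_integral_le_integral_norm hρ.1).trans
      (intervalIntegral.integral_mono_on hρ.1 ?_ ?_ fun x hx => ?_)
    · exact ((Complex.continuous_ofReal.continuousOn.mul hac).norm.mono
        hsub).intervalIntegrable_of_Icc hρ.1
    · exact ((continuousOn_const.mul hac.norm).mono hsub).intervalIntegrable_of_Icc hρ.1
    · rw [norm_mul, Complex.norm_real, Real.norm_eq_abs, abs_of_nonneg hx.1]
      exact mul_le_mul_of_nonneg_right hx.2 (norm_nonneg _)
  have h2 : ∫ r in (0 : ℝ)..ρ, ‖a r‖ ≤ ‖v‖ := by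
    have h3 : v.fn ρ = ((∫ r in (0 : ℝ)..ρ, ‖a r‖ : ℝ) : ℂ) := by
      rw [← intervalIntegral.integral_ofReal]
      exact indicator_of_mem hρ _
    have h4 := norm_le2 v hρ
    rw [h3, Complex.norm_real] at h4
    exact (le_abs_self _).trans h4
  rw [hu, indicator_of_mem hρ]
  rw [intervalIntegral.integral_const_mul] at h1
  nlinarith [hρ.1]

theorem L0fun_snd_apply (u : domL0t) {ρ : ℝ} (hρ : ρ ∈ I) :
    (L0fun u).snd.fn ρ = D u.1.fst.fn ρ / ρ - ρ * D u.1.snd.fn ρ :=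
  (show _ = l02 u.1.fst.fn u.1.snd.fn ρ from rfl).trans (indicator_of_mem hρ _)

/-- Integrating the second component of `(z - L̃₀) u = f` against `ρ` shows that the operator `K`
in `L'` gains a factor `1 / (z - 2)`. -/
theorem sub_two_mul_K_eq (z : ℂ) (u : domL0t) {ρ : ℝ} (hρ : ρ ∈ I) :
    (z - 2) * K u.1.snd.fn ρ = u.1.fst.fn ρ - (ρ : ℂ) ^ 2 * u.1.snd.fn ρ +
      K (z • u.1 - L0fun u).snd.fn ρ := by
  obtain ⟨⟨h1, h10, h1', -⟩, h2, h20⟩ := u.2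
  set f : Ht := z • u.1 - L0fun u with hf
  have hfc := f.snd.mem.1.1.continuousOn
  have huc := u.1.snd.mem.1.1.continuousOn
  have hK : ∀ w : H2t, ContDiffOn ℝ (1 : ℕ) (K w.fn) I := fun w =>
    (contDiffOn_K w.mem.1.1).of_le (by norm_num)
  have hfx : ∀ x ∈ I, f.snd.fn x =
      z * u.1.snd.fn x - (D u.1.fst.fn x / x - x * D u.1.snd.fn x) := fun x hx => by
    rw [← L0fun_snd_apply u hx]
    simp [hf]
  -- Both sides vanish at `0` and have equal derivatives; the shift by `2` comes from
  -- differentiating `ρ²u₂`.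
  have key := eq_of_D_eq (n := 1) le_rfl
    (u := I.indicator fun ρ : ℝ => (z - 2) * K u.1.snd.fn ρ)
    (v := I.indicator fun ρ : ℝ => u.1.fst.fn ρ - (ρ : ℂ) ^ 2 * u.1.snd.fn ρ + K f.snd.fn ρ)
    (mem_Ck_indicator (contDiffOn_const.mul (hK _)))
    (mem_Ck_indicator (((h1.1.of_le (by norm_num)).sub
      ((contDiffOn_id'.pow 2).mul (h2.1.of_le (by norm_num)))).add (hK _)))
    (by simp [K]) (by simp [K, h10]) (fun x hx => by
      have e := D_eq hx (((hasD h1.1 (by norm_num) hx).fun_sub ((hasD_id.fun_pow 2).fun_mul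
        (hasD h2.1 (by norm_num) hx))).fun_add (hasD_K hfc hx))
      rw [D_indicator hx, D_indicator hx, D_eq hx ((hasD_K huc hx).const_mul (z - 2)), e, hfx x hx]
      push_cast
      linear_combination -(D_fst_eq_mul u hx))
  have := congrFun key ρ
  rwa [indicator_of_mem hρ, indicator_of_mem hρ] at this

/-- The identity for `(z - 2) K u₂`, and its derivative for the term of `(L'u)₁'` containing `(K
u₂)' = ρu₂`, trade the factor `z - 2` for `u` and `f = (z - L̃₀)u`, with no further power of `z`. -/
theorem exists_norm_LpFun_le : ∃ C : ℝ, 0 ≤ C ∧ ∀ (z : ℂ) (u : domL0t),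
    ‖z - 2‖ * ‖LpFun u.1‖ ≤ C * (‖u.1‖ + ‖z • u.1 - L0fun u‖) := by
  obtain ⟨A, hA⟩ := (isCompact_Icc (a := (0 : ℝ)) (b := 1)).exists_bound_of_continuousOn
    ((contDiff_V₁_real (n := 1)).continuous_deriv (by norm_num)).continuousOn
  obtain ⟨B, hB⟩ := (isCompact_Icc (a := (0 : ℝ)) (b := 1)).exists_bound_of_continuousOn
    (contDiff_V₁_real (n := 1)).continuous.continuousOn
  have hA0 : 0 ≤ A := (norm_nonneg _).trans (hA 0 zero_mem_I)
  have hB0 : 0 ≤ B := (norm_nonneg _).trans (hB 0 zero_mem_I)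
  -- The square of the left-hand side will be at most `(12 + 3)(A + B)²s²`, hence below `16(A +
  -- B)²s²`.
  refine ⟨4 * (A + B), by positivity, fun z u => ?_⟩
  set f : Ht := z • u.1 - L0fun u with hf
  set s : ℝ := ‖u.1‖ + ‖f‖ with hs
  have hs0 : 0 ≤ s := by positivity
  set w : Ht := (z - 2) • LpFun u.1 with hw
  have hwn : ‖z - 2‖ * ‖LpFun u.1‖ = ‖w‖ := (norm_smul _ _).symm
  have j1 := integrable1_self u.1.fst
  have j2 := integrable2_self u.1.snd
  -- The values `u₁`, `u₂`, `f₂`, `K f₂` are bounded pointwise by norms, but `a` and `b` only in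
  -- `L²`; they stay on the right and are integrated afterwards. The constants come from `(x + y +
  -- w)² ≤ 3(x² + y² + w²)`.
  have hpt : ∀ x ∈ Icc (0 : ℝ) 1, ‖D w.fst.fn x‖ ^ 2 / x ^ 2 ≤ 12 * (A + B) ^ 2 * s ^ 2 +
      3 * B ^ 2 * (‖D u.1.fst.fn x‖ ^ 2 / x ^ 2 + ‖D u.1.snd.fn x‖ ^ 2) := by
    intro x hx
    rcases hx.1.eq_or_lt with h | h
    · rw [← h]; simp; positivity
    set g : ℂ := u.1.fst.fn x - (x : ℂ) ^ 2 * u.1.snd.fn x + K f.snd.fn x with hg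
    have hgK : (z - 2) * K u.1.snd.fn x = g := sub_two_mul_K_eq z u hx
    set a : ℂ := D u.1.fst.fn x / x with ha
    set b : ℂ := D u.1.snd.fn x with hb
    -- The derivative of the right-hand side of the identity for `(z - 2) K u₂`, divided by `x`.
    set g' : ℂ := a - 2 * u.1.snd.fn x - x * b + f.snd.fn x with hg'
    have hx0 : (x : ℂ) ≠ 0 := by exact_mod_cast h.ne'
    have hg'u : (z - 2) * u.1.snd.fn x = g' := by
      have e : f.snd.fn x = z * u.1.snd.fn x - (a - x * b) := by
        rw [← L0fun_snd_apply u hx]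
        simp [hf]
      rw [hg', e]; ring
    have hD : D w.fst.fn x = -((deriv V₁ x : ℝ) : ℂ) * g + -V₁ x * (x * g') := by
      rw [hw, D_smul_fst _ _ hx]
      have : D (LpFun u.1).fst.fn x = _ := lp1_hasD u.1.snd.mem.1.1.continuousOn hx
      rw [this, ← hgK, ← hg'u]; ring
    have n1 := norm_fst_fn_le u hx
    have n2 : ‖u.1.snd.fn x‖ ≤ ‖u.1‖ := (norm_le2 _ hx).trans (norm_snd_le _)
    have n3 : ‖f.snd.fn x‖ ≤ ‖f‖ := (norm_le2 _ hx).trans (norm_snd_le _)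
    have n4 : ‖K f.snd.fn x‖ ≤ ‖f‖ * x :=
      (norm_K_le _ hx).trans (mul_le_mul_of_nonneg_right (norm_snd_le _) hx.1)
    have hnx : ‖(x : ℂ)‖ = x := by rw [Complex.norm_real, Real.norm_eq_abs, abs_of_pos h]
    have ng : ‖g‖ ≤ 2 * s * x := by
      have k1 : ‖(x : ℂ) ^ 2 * u.1.snd.fn x‖ ≤ x * ‖u.1‖ := by
        rw [norm_mul, norm_pow, hnx]
        exact mul_le_mul (by nlinarith [hx.2]) n2 (norm_nonneg _) h.le
      calc ‖g‖ ≤ ‖u.1.fst.fn x‖ + ‖(x : ℂ) ^ 2 * u.1.snd.fn x‖ + ‖K f.snd.fn x‖ :=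
            (norm_add_le _ _).trans (by gcongr; exact norm_sub_le _ _)
        _ ≤ ‖u.1‖ * x + x * ‖u.1‖ + ‖f‖ * x := by gcongr
        _ ≤ 2 * s * x := by rw [hs]; nlinarith [mul_nonneg (norm_nonneg f) h.le]
    have ng' : ‖g'‖ ≤ 2 * s + ‖a‖ + ‖b‖ := by
      have k1 : ‖(x : ℂ) * b‖ ≤ ‖b‖ := by
        rw [norm_mul, hnx]; exact mul_le_of_le_one_left (norm_nonneg _) hx.2
      have k2 : ‖2 * u.1.snd.fn x‖ ≤ 2 * ‖u.1‖ := by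
        rw [norm_mul, Complex.norm_ofNat]; gcongr
      have k3 : ‖g'‖ ≤ ‖a‖ + ‖2 * u.1.snd.fn x‖ + ‖(x : ℂ) * b‖ + ‖f.snd.fn x‖ :=
        (norm_add_le _ _).trans (by
          gcongr
          exact (norm_sub_le _ _).trans (by gcongr; exact norm_sub_le _ _))
      linarith [norm_nonneg f]
    have hDn : ‖D w.fst.fn x‖ ≤ (2 * (A + B) * s + B * ‖a‖ + B * ‖b‖) * x := by
      rw [hD]
      refine (norm_add_le _ _).trans ?_
      simp only [norm_mul, norm_neg, hnx, Complex.norm_real]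
      calc _ ≤ A * (2 * s * x) + B * (x * (2 * s + ‖a‖ + ‖b‖)) := by
            gcongr
            · exact hA x hx
            · exact hB x hx
        _ = _ := by ring
    have ea : ‖D u.1.fst.fn x‖ ^ 2 / x ^ 2 = ‖a‖ ^ 2 := by
      rw [ha, norm_div, hnx, div_pow]
    rw [ea, div_le_iff₀ (by positivity)]
    calc _ ≤ ((2 * (A + B) * s + B * ‖a‖ + B * ‖b‖) * x) ^ 2 :=
          pow_le_pow_left₀ (norm_nonneg _) hDn 2
      _ = (2 * (A + B) * s + B * ‖a‖ + B * ‖b‖) ^ 2 * x ^ 2 := mul_pow _ _ _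
      _ ≤ _ := by
          refine mul_le_mul_of_nonneg_right ?_ (sq_nonneg x)
          nlinarith [sq_nonneg (2 * (A + B) * s - B * ‖a‖), sq_nonneg (2 * (A + B) * s - B * ‖b‖),
            sq_nonneg (B * ‖a‖ - B * ‖b‖)]
  have h1 : ∫ ρ in (0 : ℝ)..1, ‖D w.fst.fn ρ‖ ^ 2 / ρ ^ 2 ≤
      12 * (A + B) ^ 2 * s ^ 2 + 3 * B ^ 2 * ‖u.1‖ ^ 2 := by
    refine (intervalIntegral.integral_mono_on zero_le_one (integrable1_self _)
      (intervalIntegrable_const.add ((j1.add j2).const_mul _)) hpt).trans_eq ?_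
    rw [intervalIntegral.integral_add intervalIntegrable_const ((j1.add j2).const_mul _),
      intervalIntegral.integral_const_mul (3 * B ^ 2), intervalIntegral.integral_add j1 j2,
      ← norm_sq_Ht]
    simp
  have h2 : ∫ ρ in (0 : ℝ)..1, ‖D w.snd.fn ρ‖ ^ 2 = 0 := by
    have : w.snd = 0 := by simp [hw, LpFun]
    rw [← norm_sq2, this]; simp
  rw [hwn]
  refine (abs_le_of_sq_le_sq' ?_ (by positivity)).2
  rw [norm_sq_Ht, h2, add_zero]
  have h3 : ‖u.1‖ ^ 2 ≤ s ^ 2 := pow_le_pow_left₀ (norm_nonneg _) (by linarith [norm_nonneg f]) 2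
  have h4 : B ^ 2 ≤ (A + B) ^ 2 := pow_le_pow_left₀ hB0 (by linarith) 2
  have h5 : B ^ 2 * ‖u.1‖ ^ 2 ≤ (A + B) ^ 2 * s ^ 2 := by gcongr
  nlinarith [mul_nonneg (sq_nonneg (A + B)) (sq_nonneg s)]

/-! ### Transfer to the completion and the closure, and the Neumann series -/

theorem mem_domain_L0t_iff {x : H} : x ∈ L0t.domain ↔ ∃ u : domL0t, emb u.1 = x :=
  ⟨fun ⟨u, hu, h⟩ => ⟨⟨u, hu⟩, h⟩, fun ⟨u, h⟩ => ⟨u.1, u.2, h⟩⟩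

theorem exists_L0t_eq (x : L0t.domain) :
    ∃ u : domL0t, emb u.1 = (x : H) ∧ L0t x = emb (L0fun u) := by
  obtain ⟨u, hu⟩ := mem_domain_L0t_iff.1 x.2
  refine ⟨u, hu, ?_⟩
  rw [← L0t_apply u]
  exact congrArg _ (Subtype.ext hu.symm)

theorem dense_domain_L0t : Dense (L0t.domain : Set H) :=
  UniformSpace.Completion.denseRange_coe.dense_image emb.continuous dense_domL0t

theorem re_inner_L0t_le (x : L0t.domain) :
    (⟪(x : H), L0t x⟫_ℂ).re ≤ -(1 / 2) * ‖(x : H)‖ ^ 2 := by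
  obtain ⟨u, h1, h2⟩ := exists_L0t_eq x
  rw [h2, ← h1]
  have e1 : ⟪emb u.1, emb (L0fun u)⟫_ℂ = ⟪u.1, L0fun u⟫_ℂ :=
    UniformSpace.Completion.inner_coe _ _
  have e2 : ‖emb u.1‖ = ‖u.1‖ := UniformSpace.Completion.norm_coe _
  rw [e1, e2]
  exact re_inner_L0fun_le u

theorem denseRange_smul_sub_L0t {z : ℂ} (hz : -1 < z.re) :
    DenseRange fun x : L0t.domain => z • (x : H) - L0t x := by
  refine (UniformSpace.Completion.denseRange_coe.dense_image emb.continuous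
    (denseRange_smul_sub_L0fun hz)).mono ?_
  rintro _ ⟨_, ⟨u, rfl⟩, rfl⟩
  refine ⟨⟨emb u.1, Submodule.mem_map_of_mem u.2⟩, ?_⟩
  simp only [L0t_apply]
  exact (by rw [map_sub, map_smul] : emb (z • u.1 - L0fun u) = z • emb u.1 - emb (L0fun u)).symm

theorem isClosable_L0t : L0t.IsClosable :=
  isClosable_of_re_inner_le re_inner_L0t_le dense_domain_L0t

theorem exists_isResolventAt_L0 {z : ℂ} (hz : -(1 / 2) < z.re) :
    ∃ R : H →L[ℂ] H, IsResolventAt L0 z R ∧ ‖R‖ ≤ 1 / (z.re + 1 / 2) :=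
  exists_isResolventAt_closure re_inner_L0t_le dense_domain_L0t (by linarith)
    (denseRange_smul_sub_L0t (by linarith))

/-- The inequality is a closed condition on the graph, so it survives the closure. With `x = R f`,
where `R` is the resolvent of `L₀`, it bounds `L'R`. -/
theorem exists_norm_Lp_le : ∃ C : ℝ, 0 ≤ C ∧ ∀ (z : ℂ) (x : L0.domain),
    ‖z - 2‖ * ‖Lp (x : H)‖ ≤ C * (‖(x : H)‖ + ‖z • (x : H) - L0 x‖) := by
  obtain ⟨C, hC0, hC⟩ := exists_norm_LpFun_le
  refine ⟨C, hC0, fun z x => ?_⟩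
  refine norm_mul_le_of_closure isClosable_L0t (fun v => ?_) x
  obtain ⟨u, e1, e2⟩ := exists_L0t_eq v
  have e3 : z • (v : H) - L0t v = emb (z • u.1 - L0fun u) := by rw [map_sub, map_smul, e1, e2]
  have hn : ∀ t : Ht, ‖emb t‖ = ‖t‖ := UniformSpace.Completion.norm_coe
  rw [e3, ← e1, Lp_emb, hn, hn, hn]
  exact hC z u

theorem exists_isResolventAt_L {ε : ℝ} (hε : 0 < ε) : ∃ M C : ℝ, ∀ z : ℂ,
    -(1 / 2) + ε ≤ z.re → M ≤ ‖z‖ → ∃ R : H →L[ℂ] H, IsResolventAt L z R ∧ ‖R‖ ≤ C := by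
  obtain ⟨C, hC0, hC⟩ := exists_norm_Lp_le
  -- Of the `3`, a part `2` pays for passing from `|z|` to `|z - 2|`, and `1` keeps `|z - 2|`
  -- positive even if `C = 0`. The rest makes `‖L'R‖ ≤ ½`.
  refine ⟨2 * C * (1 / ε + 1) + 3, 2 * (1 / ε), fun z hz hM => ?_⟩
  obtain ⟨R, hR, hRn⟩ := exists_isResolventAt_L0 (z := z) (by linarith)
  have hRε : ‖R‖ ≤ 1 / ε := hRn.trans (one_div_le_one_div_of_le hε (by linarith))
  have hz2 : 2 * C * (1 / ε + 1) + 1 ≤ ‖z - 2‖ := by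
    have := norm_sub_norm_le z 2
    rw [Complex.norm_ofNat] at this
    linarith
  have hpos : 0 < ‖z - 2‖ := by
    have : 0 ≤ 2 * C * (1 / ε + 1) := by positivity
    linarith
  have hB : ‖Lp ∘L R‖ ≤ 1 / 2 := by
    refine ContinuousLinearMap.opNorm_le_bound _ (by norm_num) fun f => ?_
    obtain ⟨x, h1, h2⟩ := hR.1 f
    have h3 := hC z x
    rw [h1] at h3 h2
    rw [h2] at h3
    have h4 : ‖R f‖ ≤ 1 / ε * ‖f‖ := (R.le_opNorm f).trans (by gcongr)
    rw [ContinuousLinearMap.comp_apply]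
    refine le_of_mul_le_mul_left ?_ hpos
    calc _ ≤ C * (‖R f‖ + ‖f‖) := h3
      _ ≤ C * (1 / ε * ‖f‖ + ‖f‖) := by gcongr
      _ = (2 * C * (1 / ε + 1)) * (1 / 2 * ‖f‖) := by ring
      _ ≤ ‖z - 2‖ * (1 / 2 * ‖f‖) := by gcongr; linarith
  obtain ⟨S, hS, hSn⟩ := exists_isResolventAt_vadd hR hB
  exact ⟨S, hS, hSn.trans (by gcongr)⟩

theorem notMem_opPointSpectrum {E : Type*} [NormedAddCommGroup E] [NormedSpace ℂ E]
    {A : E →ₗ.[ℂ] E} {z : ℂ} (h : z ∈ opResolventSet A) : z ∉ opPointSpectrum A := by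
  obtain ⟨R, hR⟩ := h
  rintro ⟨u, hu, he⟩
  refine hu ?_
  rw [← hR.2 u, he, sub_self, map_zero]

end WaveMap

theorem lemma4p16 :
    (∀ ε : ℝ, 0 < ε →
      (∃ M C : ℝ, ∀ z : ℂ, -(1 / 2) + ε ≤ z.re → M ≤ ‖z‖ →
        z ∈ WaveMap.opResolventSet WaveMap.L ∧ ‖WaveMap.opResolvent WaveMap.L z‖ ≤ C) ∧
      (∃ N : ℝ, ∀ z : ℂ, -(1 / 2) + ε ≤ z.re → N ≤ |z.im| →
        z ∉ WaveMap.opSpectrum WaveMap.L)) ∧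
    (∃ N : ℝ, ∀ z : ℂ, 0 ≤ z.re → N ≤ |z.im| → z ∉ WaveMap.opPointSpectrum WaveMap.L) := by
  refine ⟨fun ε hε => ?_, ?_⟩
  · obtain ⟨M, C, h⟩ := WaveMap.exists_isResolventAt_L hε
    refine ⟨⟨M, C, fun z hz hM => ?_⟩, M, fun z hz hM => ?_⟩
    · obtain ⟨R, hR, hRn⟩ := h z hz hM
      have hmem : z ∈ WaveMap.opResolventSet WaveMap.L := ⟨R, hR⟩
      exact ⟨hmem, by rwa [(WaveMap.isResolventAt_opResolvent hmem).unique hR]⟩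
    · obtain ⟨R, hR, -⟩ := h z hz (hM.trans (Complex.abs_im_le_norm z))
      exact fun hn => hn ⟨R, hR⟩
  -- With `ε = ½` the half plane is `Re z ≥ 0`, and a point of the resolvent set is no eigenvalue.
  · obtain ⟨M, C, h⟩ := WaveMap.exists_isResolventAt_L (ε := 1 / 2) (by norm_num)
    refine ⟨M, fun z hz hM => WaveMap.notMem_opPointSpectrum ?_⟩
    obtain ⟨R, hR, -⟩ := h z (by linarith) (hM.trans (Complex.abs_im_le_norm z))
    exact ⟨R, hR⟩
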